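/- For real $p,t$ let \[ HH(p,t)=\frac{\bigl(\sin(p\sin t)-(p\sin t)\cos(p\sin t)\bigr)\bigl(e^{p\cos t}+e^{-p\cos t}-2\cos(p\sin t)\bigr)}{\sin(p\sin t)\,\bigl(2\sin t+e^{p\cos t}\sin(-t+p\sin t)-e^{-p\cos t}\sin(t+p\sin t)\bigr)}, \] and for $0<p<\pi$ let \[ H(p)=p-2\log\Bigl(2\cosh\frac p2-\frac2p\sinh\frac p2\Bigr)+\int_0^\pi HH(p,t)\,dt . \] Let also \[ H_\pi=\pi-2\log\Bigl(2\cosh\frac\pi2-\frac2\pi\sinh\frac\pi2\Bigr)+\int_0^\pi\Bigl(HH(\pi,t)-\frac{2}{\cos^2t}\Bigr)\,dt . \] The integrals in these definitions converge, and the following hold. (a) As $p\searrow0$, \[H(p)=p+\tfrac14p^2+\tfrac{23}{864}p^4+O(p^6).\] (b) As $p\nearrow\pi$, \[H(p)=\frac{2\pi^2}{\sqrt{\pi^2-p^2}}+H_\pi+o(1)=\frac{\sqrt2\,\pi^{3/2}}{\sqrt{\pi-p}}+H_\pi+o(1)=p\sqrt{\frac{\pi+p}{\pi-p}}+H_\pi+o(1).\]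 Moreover, the integrand $HH(\pi,t)-2/\cos^2t$ of $H_\pi$ extends, across its removable singularities $t=0,\pi/2,\pi$, to a smooth function of $t\in[0,\pi]$, and numerically $H_\pi=-2.513\ldots$, that is, $-2.514<H_\pi\le-2.513$. (c) For $0<p<\pi$, \[H(p)\le(1+o(1))\,p\sqrt{\frac{\pi+p}{\pi-p}},\] where $o(1)$ denotes a function of $p$ that tends to $0$ both as $p\searrow0$ and as $p\nearrow\pi$. -/

import Mathlib

/-!
In terms of the entire functions `v ↦ cosh √v`, `v ↦ sinh √v / √v` and
`v ↦ (cosh √v - sinh √v / √v) / v`, evaluated at `-(p sin t)²` and `(p cos t)²`, the integrand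
`HH p t` extends continuously to the ends of `[0, π]`: for `0 < p < π` the new denominator vanishes
nowhere. Near `p = 0` both `HH p t` and the logarithm expand in powers of `p²`, which gives the
behaviour at `0`. The singularity that appears at `t = π / 2` as `p → π` comes only from the simple
zero of `sin √w / √w` at `w = π²`. Its leading part `2 / (1 - (p sin t / π)²)` has the explicit
integral `2π² / √(π² - p²)`, the difference stays bounded, and by dominated convergence its integral
tends to that of `HH π t - 2 / cos² t`.

For the numerical value, the zeros of numerator and denominator of `HH π t - 2 / cos² t` at
`t = π / 2` are divided out at the level of the power series. The quotient is a smooth function of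
`sin² t`; truncated power series in `cos 2t` with rational coefficients and explicit remainder
bounds show that it is close to a polynomial, whose integral is rational.
-/

open Real Set Filter Topology MeasureTheory Asymptotics
open scoped ContDiff

noncomputable section

namespace MagnusHilbert

/-- The integrand `HH(p,t)` in the norm bound for the logarithm. The quotient is `0/0` at `t = 0`
and `t = π`, and for `p = π` also at `t = π/2`; these finitely many values of `t` do not
influence the integrals below. -/
def HH (p t : ℝ) : ℝ :=
  ((sin (p * sin t) - (p * sin t) * cos (p * sin t)) *
      (exp (p * cos t) + exp (-(p * cos t)) - 2 * cos (p * sin t))) /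
    (sin (p * sin t) *
      (2 * sin t + exp (p * cos t) * sin (-t + p * sin t)
        - exp (-(p * cos t)) * sin (t + p * sin t)))

/-- The function `H(p)`, meaningful for `0 < p < π`. -/
def H (p : ℝ) : ℝ :=
  p - 2 * log (2 * cosh (p / 2) - 2 / p * sinh (p / 2)) + ∫ t in (0 : ℝ)..π, HH p t

/-- The integrand in the definition of the constant `H_π`. -/
def HpiIntegrand (t : ℝ) : ℝ := HH π t - 2 / cos t ^ 2

/-- The constant `H_π`. -/
def Hpi : ℝ :=
  π - 2 * log (2 * cosh (π / 2) - 2 / π * sinh (π / 2)) + ∫ t in (0 : ℝ)..π, HpiIntegrand t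

end MagnusHilbert

end

noncomputable section

open scoped Nat

namespace MagnusHilbert

/-! ### Entire power series -/

/-- The sum `∑ aₖ vᵏ` of the power series with coefficients `a`. -/
def powSum (a : ℕ → ℝ) (v : ℝ) : ℝ := ∑' k, a k * v ^ k

lemma powSum_zero (a : ℕ → ℝ) : powSum a 0 = a 0 :=
  (tsum_eq_single 0 fun k hk => by simp [hk]).trans (by simp)

/-- Coefficient sequences bounded by those of the exponential series; their power series define
entire functions. -/
def ExpBounded (a : ℕ → ℝ) : Prop := ∀ k, |a k| ≤ 1 / (k ! : ℝ)

namespace ExpBounded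

variable {a : ℕ → ℝ}

lemma of_eq_one_div_factorial {n : ℕ → ℕ} (hn : ∀ k, k ≤ n k)
    (ha : ∀ k, a k = 1 / ((n k)! : ℝ)) : ExpBounded a := fun k => by
  rw [ha, abs_of_nonneg (by positivity)]
  have : (k ! : ℝ) ≤ (n k)! := mod_cast Nat.factorial_le (hn k)
  gcongr

lemma shift (ha : ExpBounded a) (n : ℕ) : ExpBounded fun k => a (k + n) := fun k => by
  have : (k ! : ℝ) ≤ (k + n)! := mod_cast Nat.factorial_le (Nat.le_add_right k n)
  exact (ha (k + n)).trans (by gcongr)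

lemma summable_abs (ha : ExpBounded a) (v : ℝ) : Summable fun k => |a k * v ^ k| := by
  refine (Real.summable_pow_div_factorial |v|).of_nonneg_of_le (fun _ => abs_nonneg _) fun k => ?_
  rw [abs_mul, abs_pow, div_eq_mul_one_div, mul_comm]
  exact mul_le_mul_of_nonneg_left (ha k) (by positivity)

lemma hasSum (ha : ExpBounded a) (v : ℝ) : HasSum (fun k => a k * v ^ k) (powSum a v) :=
  (ha.summable_abs v).of_abs.hasSum

lemma powSum_eq_sum_add (ha : ExpBounded a) (n : ℕ) (v : ℝ) :
    powSum a v = ∑ k ∈ Finset.range n, a k * v ^ k + v ^ n * powSum (fun k => a (k + n)) v := by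
  rw [powSum, ← (ha.summable_abs v).of_abs.sum_add_tsum_nat_add n, powSum, ← tsum_mul_left]
  simp only [pow_add, mul_left_comm, mul_comm]

lemma contDiff_powSum (ha : ExpBounded a) : ContDiff ℝ ω (powSum a) := by
  set q := FormalMultilinearSeries.ofScalars ℝ a
  have radius_eq_top : q.radius = ⊤ :=
    q.radius_eq_top_of_summable_norm fun r => (ha.summable_abs r).congr fun k => by
      simp [q, abs_mul]
  have sum_eq : q.sum = powSum a := by
    funext v
    simpa [FormalMultilinearSeries.ofScalarsSum, powSum, q] using
      FormalMultilinearSeries.ofScalars_sum_eq (E := ℝ) a v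
  have hq := q.hasFPowerSeriesOnBall (by simp [radius_eq_top])
  rw [sum_eq] at hq
  exact contDiff_omega_iff_analyticOnNhd.mpr fun v _ =>
    hq.analyticAt_of_mem (by simp [radius_eq_top])

end ExpBounded

lemma powSum_nonneg {a : ℕ → ℝ} (ha : ∀ k, 0 ≤ a k) {v : ℝ} (hv : 0 ≤ v) : 0 ≤ powSum a v :=
  tsum_nonneg fun k => mul_nonneg (ha k) (pow_nonneg hv k)

lemma contDiff_dslope {f : ℝ → ℝ} (hf : ContDiff ℝ ω f) (a : ℝ) : ContDiff ℝ ω (dslope f a) := by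
  rw [contDiff_omega_iff_analyticOnNhd] at hf ⊢
  intro x _
  rcases eq_or_ne x a with rfl | hx
  · obtain ⟨q, hq⟩ := hf x trivial
    exact hq.has_fpower_series_dslope_fslope.analyticAt
  · have analyticAt_slope : AnalyticAt ℝ (fun y => (f y - f a) / (y - a)) x :=
      ((hf x trivial).sub analyticAt_const).div (analyticAt_id.sub analyticAt_const)
        (sub_ne_zero.mpr hx)
    refine analyticAt_slope.congr ?_
    filter_upwards [isOpen_ne.mem_nhds hx] with y hy
    rw [dslope_of_ne _ hy, slope_def_field]

/-! ### `cosh √v`, `sinh √v / √v` and the kernel of `HH` -/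

/-- Coefficients of `cosh √v`. -/
def coshCoeff (k : ℕ) : ℝ := 1 / ((2 * k)! : ℝ)

/-- Coefficients of `sinh √v / √v`. -/
def sinhcCoeff (k : ℕ) : ℝ := 1 / ((2 * k + 1)! : ℝ)

/-- Coefficients of `(cosh √v - sinh √v / √v) / v`. -/
def besselCoeff (k : ℕ) : ℝ := 2 * (k + 1) / ((2 * k + 3)! : ℝ)

lemma expBounded_coshCoeff : ExpBounded coshCoeff :=
  .of_eq_one_div_factorial (n := fun k => 2 * k) (fun k => by omega) fun _ => rfl

lemma expBounded_sinhcCoeff : ExpBounded sinhcCoeff :=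
  .of_eq_one_div_factorial (n := fun k => 2 * k + 1) (fun k => by omega) fun _ => rfl

lemma besselCoeff_eq_sub (k : ℕ) :
    besselCoeff k = coshCoeff (k + 1) - sinhcCoeff (k + 1) := by
  simp only [besselCoeff, coshCoeff, sinhcCoeff, Nat.mul_add, mul_one, Nat.factorial_succ]
  push_cast
  field_simp
  ring

lemma expBounded_besselCoeff : ExpBounded besselCoeff := fun k => by
  have hnonneg : 0 ≤ besselCoeff k := by unfold besselCoeff; positivity
  have hsinhc : 0 ≤ sinhcCoeff (k + 1) := by unfold sinhcCoeff; positivity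
  rw [abs_of_nonneg hnonneg, besselCoeff_eq_sub]
  linarith [le_abs_self (coshCoeff (k + 1)), expBounded_coshCoeff.shift 1 k]

/-- The entire function `cosh √v`, equal to `cos √(-v)` for `v ≤ 0`. -/
def coshSqrt : ℝ → ℝ := powSum coshCoeff

/-- The entire function `sinh √v / √v`, equal to `sin √(-v) / √(-v)` for `v < 0`. -/
def sinhcSqrt : ℝ → ℝ := powSum sinhcCoeff

/-- The entire function `(cosh √v - sinh √v / √v) / v`. At `v = -s²` it is `j₁(s) / s`, with `j₁`
the spherical Bessel function. -/
def besselSqrt : ℝ → ℝ := powSum besselCoeff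

@[fun_prop]
lemma contDiff_coshSqrt {n : WithTop ℕ∞} : ContDiff ℝ n coshSqrt :=
  expBounded_coshCoeff.contDiff_powSum.of_le le_top

@[fun_prop]
lemma contDiff_sinhcSqrt {n : WithTop ℕ∞} : ContDiff ℝ n sinhcSqrt :=
  expBounded_sinhcCoeff.contDiff_powSum.of_le le_top

@[fun_prop]
lemma contDiff_besselSqrt {n : WithTop ℕ∞} : ContDiff ℝ n besselSqrt :=
  expBounded_besselCoeff.contDiff_powSum.of_le le_top

lemma coshSqrt_sq (x : ℝ) : coshSqrt (x ^ 2) = cosh x :=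
  HasSum.tsum_eq <| (Real.hasSum_cosh x).congr_fun fun k => by rw [coshCoeff, ← pow_mul]; ring

lemma coshSqrt_neg_sq (x : ℝ) : coshSqrt (-x ^ 2) = cos x :=
  HasSum.tsum_eq <| (Real.hasSum_cos x).congr_fun fun k => by
    rw [coshCoeff, neg_pow, ← pow_mul]; ring

lemma mul_sinhcSqrt_sq (x : ℝ) : x * sinhcSqrt (x ^ 2) = sinh x :=
  ((expBounded_sinhcCoeff.hasSum (x ^ 2)).mul_left x).unique <|
    (Real.hasSum_sinh x).congr_fun fun k => by rw [sinhcCoeff, ← pow_mul]; ring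

lemma mul_sinhcSqrt_neg_sq (x : ℝ) : x * sinhcSqrt (-x ^ 2) = sin x :=
  ((expBounded_sinhcCoeff.hasSum (-x ^ 2)).mul_left x).unique <|
    (Real.hasSum_sin x).congr_fun fun k => by rw [sinhcCoeff, neg_pow, ← pow_mul]; ring

lemma mul_besselSqrt (v : ℝ) : v * besselSqrt v = coshSqrt v - sinhcSqrt v := by
  have hcosh := expBounded_coshCoeff.powSum_eq_sum_add 1 v
  have hsinhc := expBounded_sinhcCoeff.powSum_eq_sum_add 1 v
  have hbessel : besselSqrt v =
      powSum (fun k => coshCoeff (k + 1)) v - powSum (fun k => sinhcCoeff (k + 1)) v :=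
    (expBounded_besselCoeff.hasSum v).unique <|
      (((expBounded_coshCoeff.shift 1).hasSum v).sub
        ((expBounded_sinhcCoeff.shift 1).hasSum v)).congr_fun fun k => by
          rw [besselCoeff_eq_sub, sub_mul]
  rw [hbessel, coshSqrt, sinhcSqrt, hcosh, hsinhc]
  simp [coshCoeff, sinhcCoeff, mul_sub]

lemma pow_mul_besselSqrt (x : ℝ) : x ^ 3 * besselSqrt (-x ^ 2) = sin x - x * cos x := by
  have h := mul_besselSqrt (-x ^ 2)
  rw [coshSqrt_neg_sq] at h
  rw [← mul_sinhcSqrt_neg_sq x]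
  linear_combination (-x) * h

lemma coshSqrt_zero : coshSqrt 0 = 1 := by
  simp [coshSqrt, powSum_zero, coshCoeff]

lemma sinhcSqrt_zero : sinhcSqrt 0 = 1 := by
  simp [sinhcSqrt, powSum_zero, sinhcCoeff]

/-- The entire function `(cosh √v - 1) / v`. -/
def coshSlope : ℝ → ℝ := powSum fun k => coshCoeff (k + 1)

lemma coshSqrt_eq_one_add (v : ℝ) : coshSqrt v = 1 + v * coshSlope v := by
  rw [coshSqrt, expBounded_coshCoeff.powSum_eq_sum_add 1 v, coshSlope]
  simp [coshCoeff]

lemma sinhcSqrt_le_coshSqrt {v : ℝ} (hv : 0 ≤ v) : sinhcSqrt v ≤ coshSqrt v := by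
  have : 0 ≤ besselSqrt v := powSum_nonneg (fun k => by unfold besselCoeff; positivity) hv
  linarith [mul_besselSqrt v, mul_nonneg hv this]

lemma one_add_half_le_coshSqrt {v : ℝ} (hv : 0 ≤ v) : 1 + v / 2 ≤ coshSqrt v := by
  have htail : 0 ≤ powSum (fun k => coshCoeff (k + 2)) v :=
    powSum_nonneg (fun k => by unfold coshCoeff; positivity) hv
  have hsum : ∑ k ∈ Finset.range 2, coshCoeff k * v ^ k = 1 + v / 2 := by
    norm_num [Finset.sum_range_succ, coshCoeff]; ring
  rw [coshSqrt, expBounded_coshCoeff.powSum_eq_sum_add 2, hsum]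
  linarith [mul_nonneg (sq_nonneg v) htail]

lemma two_mul_coshSqrt_sub_one_le {v : ℝ} (hv : 0 ≤ v) :
    2 * (coshSqrt v - 1) ≤ v * sinhcSqrt v := by
  have hcoeff (k : ℕ) : 2 * coshCoeff (k + 1) ≤ sinhcCoeff k := by
    rw [coshCoeff, sinhcCoeff, Nat.mul_succ, Nat.factorial_succ (2 * k + 1)]
    push_cast
    rw [mul_one_div, div_le_div_iff₀ (by positivity) (by positivity)]
    nlinarith [mul_nonneg (Nat.cast_nonneg (α := ℝ) k)
      (Nat.cast_nonneg (α := ℝ) (2 * k + 1).factorial)]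
  have hle : 2 * coshSlope v ≤ sinhcSqrt v :=
    hasSum_le (fun k => by
        rw [← mul_assoc]; exact mul_le_mul_of_nonneg_right (hcoeff k) (pow_nonneg hv k))
      (((expBounded_coshCoeff.shift 1).hasSum v).mul_left 2) (expBounded_sinhcCoeff.hasSum v)
  rw [coshSqrt_eq_one_add]
  linarith [mul_le_mul_of_nonneg_left hle hv]

lemma mul_cos_le_sin {s : ℝ} (h0 : 0 ≤ s) (hpi : s ≤ π) : s * cos s ≤ sin s := by
  rcases lt_or_ge s (π / 2) with h | h
  · have hcos : 0 < cos s := cos_pos_of_mem_Ioo ⟨by linarith [pi_pos], h⟩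
    have := le_tan h0 h
    rwa [tan_eq_sin_div_cos, le_div_iff₀ hcos] at this
  · have hcos : cos s ≤ 0 := cos_nonpos_of_pi_div_two_le_of_le h (by linarith [pi_pos])
    exact (mul_nonpos_of_nonneg_of_nonpos h0 hcos).trans (sin_nonneg_of_nonneg_of_le_pi h0 hpi)

lemma cos_le_sinhcSqrt {s : ℝ} (h0 : 0 ≤ s) (hpi : s ≤ π) : cos s ≤ sinhcSqrt (-s ^ 2) := by
  rcases h0.eq_or_lt with rfl | h
  · simp [sinhcSqrt_zero]
  · have := mul_cos_le_sin h0 hpi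
    rw [← mul_sinhcSqrt_neg_sq] at this
    exact le_of_mul_le_mul_left this h

lemma sinhcSqrt_pos {s : ℝ} (h0 : 0 ≤ s) (hpi : s < π) : 0 < sinhcSqrt (-s ^ 2) := by
  rcases h0.eq_or_lt with rfl | h
  · simp [sinhcSqrt_zero]
  · have := sin_pos_of_pos_of_lt_pi h hpi
    rw [← mul_sinhcSqrt_neg_sq] at this
    exact pos_of_mul_pos_right this h0

lemma sinhcSqrt_neg_pi_sq : sinhcSqrt (-π ^ 2) = 0 := by
  have := mul_sinhcSqrt_neg_sq π
  rw [sin_pi] at this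
  exact (mul_eq_zero.mp this).resolve_left pi_ne_zero

lemma sinhcSqrt_nonneg {s : ℝ} (h0 : 0 ≤ s) (hpi : s ≤ π) : 0 ≤ sinhcSqrt (-s ^ 2) := by
  rcases hpi.eq_or_lt with rfl | h
  · rw [sinhcSqrt_neg_pi_sq]
  · exact (sinhcSqrt_pos h0 h).le

/-- The numerator of `HH p t` divided by `2 (p sin t)³`, at `a = -(p sin t)²` and
`b = (p cos t)²`. -/
def kernelNum (a b : ℝ) : ℝ := besselSqrt a * (coshSqrt b - coshSqrt a)

/-- The second factor of the denominator of `HH p t` divided by `2 sin t`, at `a = -(p sin t)²` and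
`b = (p cos t)²`. -/
def kernelDen (a b : ℝ) : ℝ := 1 - coshSqrt a * coshSqrt b + sinhcSqrt a * (b * sinhcSqrt b)

lemma two_mul_sin_mul_kernelDen (p t : ℝ) :
    2 * sin t * kernelDen (-(p * sin t) ^ 2) ((p * cos t) ^ 2) =
      2 * sin t + exp (p * cos t) * sin (-t + p * sin t)
        - exp (-(p * cos t)) * sin (t + p * sin t) := by
  set s := p * sin t with hs
  set c := p * cos t with hc
  have hsinh : c ^ 2 * sinhcSqrt (c ^ 2) = c * sinh c := by rw [← mul_sinhcSqrt_sq]; ring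
  have hsin : cos t * sin s = c * sin t * sinhcSqrt (-s ^ 2) := by
    rw [← mul_sinhcSqrt_neg_sq, hs, hc]; ring
  rw [kernelDen, hsinh, coshSqrt_sq, coshSqrt_neg_sq, sin_add, sin_add, sin_neg, cos_neg,
    ← cosh_add_sinh c, ← cosh_sub_sinh c]
  linear_combination (-2 * sinh c) * hsin

lemma HH_eq_kernelNum_div_kernelDen {p t : ℝ} (hp : p ≠ 0) (ht : sin t ≠ 0) :
    HH p t = p ^ 2 * sin t * kernelNum (-(p * sin t) ^ 2) ((p * cos t) ^ 2) /
      (sinhcSqrt (-(p * sin t) ^ 2) * kernelDen (-(p * sin t) ^ 2) ((p * cos t) ^ 2)) := by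
  have : p * sin t ≠ 0 := mul_ne_zero hp ht
  have hcosh : exp (p * cos t) + exp (-(p * cos t)) - 2 * cos (p * sin t) =
      2 * (coshSqrt ((p * cos t) ^ 2) - coshSqrt (-(p * sin t) ^ 2)) := by
    rw [coshSqrt_sq, coshSqrt_neg_sq, cosh_eq]; ring
  rw [HH, hcosh, ← two_mul_sin_mul_kernelDen, ← pow_mul_besselSqrt (p * sin t),
    ← mul_sinhcSqrt_neg_sq (p * sin t), kernelNum]
  rw [← mul_div_mul_left _ (sinhcSqrt _ * _) (by positivity : 2 * (p * sin t) * sin t ≠ 0)]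
  congr 1 <;> ring

lemma le_kernelDen {s b : ℝ} (h0 : 0 ≤ s) (hpi : s ≤ π) (hb : 0 ≤ b) :
    (1 - cos s) + sinhcSqrt (-s ^ 2) * (coshSqrt b - 1) ≤ kernelDen (-s ^ 2) b := by
  have hcosh : 0 ≤ coshSqrt b - 1 := by linarith [one_add_half_le_coshSqrt hb]
  rw [kernelDen, coshSqrt_neg_sq]
  nlinarith [mul_le_mul_of_nonneg_left (two_mul_coshSqrt_sub_one_le hb) (sinhcSqrt_nonneg h0 hpi),
    mul_le_mul_of_nonneg_right (cos_le_sinhcSqrt h0 hpi) hcosh]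

lemma kernelDen_pos {s b : ℝ} (h0 : 0 ≤ s) (hpi : s ≤ π) (hb : 0 ≤ b) (h : s ≠ 0 ∨ b ≠ 0) :
    0 < kernelDen (-s ^ 2) b := by
  refine lt_of_lt_of_le ?_ (le_kernelDen h0 hpi hb)
  have hcosh := one_add_half_le_coshSqrt hb
  rcases h0.eq_or_lt with rfl | hs
  · have : 0 < b := hb.lt_of_ne' (by simpa using h)
    rw [cos_zero, zero_pow two_ne_zero, neg_zero, sinhcSqrt_zero]
    linarith
  · have : cos s < 1 := cos_zero ▸ cos_lt_cos_of_nonneg_of_le_pi le_rfl hpi hs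
    nlinarith [sinhcSqrt_nonneg h0 hpi]

/-- The quotient `(f y - f 1) / (1 - y)`, extended to `y = 1` by `-f' 1`. -/
def divOneSub (f : ℝ → ℝ) (y : ℝ) : ℝ := -dslope f 1 y

lemma one_sub_mul_divOneSub (f : ℝ → ℝ) (y : ℝ) : (1 - y) * divOneSub f y = f y - f 1 := by
  rw [← sub_smul_dslope, divOneSub, smul_eq_mul]; ring

lemma contDiff_divOneSub {f : ℝ → ℝ} (hf : ContDiff ℝ ω f) {n : WithTop ℕ∞} :
    ContDiff ℝ n (divOneSub f) :=
  (contDiff_dslope hf 1).neg.of_le le_top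

/-- The function `sin (π √y) / (π √y (1 - y))`. -/
def sincQuot : ℝ → ℝ := divOneSub fun y => sinhcSqrt (-(π ^ 2 * y))

@[fun_prop]
lemma contDiff_sincQuot {n : WithTop ℕ∞} : ContDiff ℝ n sincQuot :=
  contDiff_divOneSub (by fun_prop)

lemma one_sub_mul_sincQuot (y : ℝ) : (1 - y) * sincQuot y = sinhcSqrt (-(π ^ 2 * y)) := by
  rw [sincQuot, one_sub_mul_divOneSub, mul_one, sinhcSqrt_neg_pi_sq, sub_zero]

lemma sincQuot_one : sincQuot 1 = 1 / 2 := by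
  have hfactor : (fun s : ℝ => s * (1 - (s / π) ^ 2) * sincQuot ((s / π) ^ 2)) = sin := by
    funext s
    rw [mul_assoc, one_sub_mul_sincQuot, ← mul_sinhcSqrt_neg_sq]
    congr 3
    field_simp
  have hleft : HasDerivAt (fun s : ℝ => s * (1 - (s / π) ^ 2)) (-2) π :=
    ((hasDerivAt_id' π).fun_mul
      ((((hasDerivAt_id' π).div_const π).fun_pow 2).const_sub 1)).congr_deriv (by
        simp only [div_self pi_ne_zero]; field_simp; norm_num)
  have hright : DifferentiableAt ℝ (fun s : ℝ => sincQuot ((s / π) ^ 2)) π :=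
    (by fun_prop : ContDiff ℝ 1 _).differentiable one_ne_zero π
  have hderiv := hleft.mul hright.hasDerivAt
  simp only [div_self pi_ne_zero, one_pow, sub_self, mul_zero, zero_mul, add_zero] at hderiv
  have := hderiv.unique (hfactor ▸ hasDerivAt_sin π)
  rw [cos_pi] at this
  linarith

lemma sincQuot_pos {y : ℝ} (h0 : 0 ≤ y) (h1 : y ≤ 1) : 0 < sincQuot y := by
  rcases h1.eq_or_lt with rfl | h
  · rw [sincQuot_one]; norm_num
  · have hsqrt : √y < 1 := by rwa [sqrt_lt' one_pos, one_pow]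
    have hpos : 0 < sinhcSqrt (-(π * √y) ^ 2) :=
      sinhcSqrt_pos (by positivity) (by nlinarith [pi_pos])
    rw [mul_pow, sq_sqrt h0, ← one_sub_mul_sincQuot] at hpos
    exact pos_of_mul_pos_right hpos (by linarith)

/-- The function `HH p t * (1 - (p sin t / π)²)` of `p` and `r = sin t`, whose factor vanishing at
`p sin t = π` cancels the singularity of `HH π` at `t = π / 2`. -/
def regKernel (x : ℝ × ℝ) : ℝ :=
  x.1 ^ 2 * x.2 * kernelNum (-(x.1 * x.2) ^ 2) (x.1 ^ 2 * (1 - x.2 ^ 2)) /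
    (sincQuot ((x.1 * x.2 / π) ^ 2) * kernelDen (-(x.1 * x.2) ^ 2) (x.1 ^ 2 * (1 - x.2 ^ 2)))

lemma contDiffAt_regKernel {x : ℝ × ℝ} (h1 : x.1 ∈ Ioc 0 π) (h2 : x.2 ∈ Icc 0 1)
    {n : WithTop ℕ∞} : ContDiffAt ℝ n regKernel x := by
  have hs0 : 0 ≤ x.1 * x.2 := mul_nonneg h1.1.le h2.1
  have hs : x.1 * x.2 ≤ π := (mul_le_of_le_one_right h1.1.le h2.2).trans h1.2
  have hsinc : 0 < sincQuot ((x.1 * x.2 / π) ^ 2) :=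
    sincQuot_pos (by positivity) (pow_le_one₀ (by positivity) ((div_le_one pi_pos).mpr hs))
  have hb : 0 ≤ 1 - x.2 ^ 2 := by nlinarith [h2.1, h2.2]
  have hden : 0 < kernelDen (-(x.1 * x.2) ^ 2) (x.1 ^ 2 * (1 - x.2 ^ 2)) := by
    refine kernelDen_pos hs0 hs (by positivity) ?_
    rcases eq_or_ne x.2 0 with h | h
    · exact .inr (by simp [h, h1.1.ne'])
    · exact .inl (mul_ne_zero h1.1.ne' h)
  unfold regKernel
  refine ContDiffAt.div ?_ ?_ (mul_pos hsinc hden).ne'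
  · unfold kernelNum; fun_prop
  · unfold kernelDen; fun_prop

lemma pi_sq_mul_besselSqrt : π ^ 2 * besselSqrt (-π ^ 2) = 1 := by
  have := pow_mul_besselSqrt π
  rw [sin_pi, cos_pi] at this
  exact mul_left_cancel₀ pi_ne_zero (by linear_combination this)

lemma coshSqrt_neg_pi_sq : coshSqrt (-π ^ 2) = -1 := by rw [coshSqrt_neg_sq, cos_pi]

lemma regKernel_pi_one : regKernel (π, 1) = 2 := by
  simp only [regKernel, kernelNum, kernelDen, mul_one, one_pow, sub_self, mul_zero, coshSqrt_zero,
    sinhcSqrt_neg_pi_sq, coshSqrt_neg_pi_sq, div_self pi_ne_zero, sincQuot_one]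
  linear_combination 2 * pi_sq_mul_besselSqrt

lemma HH_eq_regKernel_div {p t : ℝ} (hp : p ≠ 0) (ht : sin t ≠ 0) :
    HH p t = regKernel (p, sin t) / (1 - (p * sin t / π) ^ 2) := by
  have hsinhc : sinhcSqrt (-(p * sin t) ^ 2) =
      (1 - (p * sin t / π) ^ 2) * sincQuot ((p * sin t / π) ^ 2) := by
    rw [one_sub_mul_sincQuot]
    congr 1
    field_simp
  rw [HH_eq_kernelNum_div_kernelDen hp ht, hsinhc, regKernel, div_div, mul_pow p (cos t), cos_sq']
  congr 1
  ring

lemma one_sub_sq_pos {p t : ℝ} (hp : 0 < p) (hpi : p < π) (ht : 0 ≤ sin t) :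
    0 < 1 - (p * sin t / π) ^ 2 := by
  have h : p * sin t / π < 1 := by
    rw [div_lt_one pi_pos]; exact (mul_le_of_le_one_right hp.le (sin_le_one t)).trans_lt hpi
  have : 0 ≤ p * sin t / π := by positivity
  nlinarith

lemma intervalIntegrable_HH {p : ℝ} (hp : p ∈ Ioo 0 π) :
    IntervalIntegrable (HH p) volume 0 π := by
  have hcont : ContinuousOn (fun t => regKernel (p, sin t) / (1 - (p * sin t / π) ^ 2))
      (uIcc 0 π) := by
    rw [uIcc_of_le pi_pos.le]
    refine ContinuousOn.div (fun t ht => ?_) (by fun_prop) fun t ht =>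
      (one_sub_sq_pos hp.1 hp.2 (sin_nonneg_of_mem_Icc ht)).ne'
    have hreg : ContDiffAt ℝ 0 regKernel (p, sin t) :=
      contDiffAt_regKernel ⟨hp.1, hp.2.le⟩ ⟨sin_nonneg_of_mem_Icc ht, sin_le_one t⟩
    exact (hreg.continuousAt.comp (f := fun t => (p, sin t)) (by fun_prop)).continuousWithinAt
  refine hcont.intervalIntegrable.congr_uIoo fun t ht => ?_
  rw [uIoo_of_le pi_pos.le] at ht
  exact (HH_eq_regKernel_div hp.1.ne' (sin_pos_of_mem_Ioo ht).ne').symm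

/-! ### Behaviour as `p → π` -/

lemma exists_abs_regKernel_sub_two_le : ∃ K : ℝ, 0 ≤ K ∧
    ∀ p ∈ Icc (π / 2) π, ∀ r ∈ Icc 0 1, |regKernel (p, r) - 2| ≤ K * (π - p * r) := by
  have hhalf : π / 2 ≤ π := by linarith [pi_pos]
  have hsmooth : ContDiffOn ℝ 1 regKernel (Icc (π / 2) π ×ˢ Icc 0 1) := fun x hx =>
    (contDiffAt_regKernel ⟨by linarith [hx.1.1, pi_pos], hx.1.2⟩ hx.2).contDiffWithinAt
  obtain ⟨K, hK⟩ := hsmooth.exists_lipschitzOnWith one_ne_zero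
    ((convex_Icc _ _).prod (convex_Icc _ _)) (isCompact_Icc.prod isCompact_Icc)
  refine ⟨K, K.2, fun p hp r hr => ?_⟩
  have hlip := hK.dist_le_mul (p, r) ⟨hp, hr⟩ (π, 1)
    ⟨right_mem_Icc.mpr hhalf, right_mem_Icc.mpr zero_le_one⟩
  rw [regKernel_pi_one, Real.dist_eq] at hlip
  refine hlip.trans (mul_le_mul_of_nonneg_left ?_ K.2)
  rw [Prod.dist_eq, Real.dist_eq, Real.dist_eq, abs_sub_comm p, abs_sub_comm r,
    abs_of_nonneg (sub_nonneg.mpr hp.2), abs_of_nonneg (sub_nonneg.mpr hr.2)]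
  exact max_le (by nlinarith [hp.1, hr.2, pi_pos]) (by nlinarith [hp.1, hp.2, hr.2, pi_gt_three])

/-- The model integrand, which carries the singularity of `HH p t` at `t = π / 2` as `p → π`. -/
def singularPart (p t : ℝ) : ℝ := 2 / (1 - (p * sin t / π) ^ 2)

lemma HH_sub_singularPart {p t : ℝ} (hp : p ≠ 0) (ht : sin t ≠ 0) :
    HH p t - singularPart p t = (regKernel (p, sin t) - 2) / (1 - (p * sin t / π) ^ 2) := by
  rw [HH_eq_regKernel_div hp ht, singularPart, sub_div]

lemma HpiIntegrand_eq_sub_singularPart (t : ℝ) :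
    HpiIntegrand t = HH π t - singularPart π t := by
  rw [HpiIntegrand, singularPart, mul_div_cancel_left₀ _ pi_ne_zero, cos_sq']

lemma exists_abs_HH_sub_singularPart_le :
    ∃ C : ℝ, ∀ p ∈ Ioo (π / 2) π, ∀ t ∈ Ioo 0 π, |HH p t - singularPart p t| ≤ C := by
  obtain ⟨K, hK0, hK⟩ := exists_abs_regKernel_sub_two_le
  refine ⟨K * π, fun p hp t ht => ?_⟩
  have hp0 : 0 < p := by linarith [hp.1, pi_pos]
  have hsin : 0 < sin t := sin_pos_of_mem_Ioo ht
  have hden := one_sub_sq_pos hp0 hp.2 hsin.le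
  have hle : 1 - p * sin t / π ≤ 1 - (p * sin t / π) ^ 2 := by
    have : 0 ≤ p * sin t / π := by positivity
    nlinarith
  rw [HH_sub_singularPart hp0.ne' hsin.ne', abs_div, abs_of_pos hden, div_le_iff₀ hden]
  calc |regKernel (p, sin t) - 2| ≤ K * (π - p * sin t) :=
        hK p ⟨hp.1.le, hp.2.le⟩ _ ⟨hsin.le, sin_le_one t⟩
    _ = K * π * (1 - p * sin t / π) := by field_simp
    _ ≤ K * π * (1 - (p * sin t / π) ^ 2) := by gcongr

lemma cos_ne_zero_of_ne_pi_div_two {t : ℝ} (ht : t ∈ Icc 0 π) (hne : t ≠ π / 2) : cos t ≠ 0 :=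
  fun h => hne <| injOn_cos ht ⟨by linarith [pi_pos], by linarith [pi_pos]⟩ <| by
    rw [h, cos_pi_div_two]

lemma tendsto_HH_sub_singularPart {t : ℝ} (ht : t ∈ Ioo 0 π) (hne : t ≠ π / 2) :
    Tendsto (fun p => HH p t - singularPart p t) (𝓝[<] π) (𝓝 (HpiIntegrand t)) := by
  have hsin : 0 < sin t := sin_pos_of_mem_Ioo ht
  have hden : 1 - (π * sin t / π) ^ 2 ≠ 0 := by
    rw [mul_div_cancel_left₀ _ pi_ne_zero, ← cos_sq']
    exact pow_ne_zero 2 (cos_ne_zero_of_ne_pi_div_two (Ioo_subset_Icc_self ht) hne)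
  have hreg : ContDiffAt ℝ 0 regKernel (π, sin t) :=
    contDiffAt_regKernel ⟨pi_pos, le_rfl⟩ ⟨hsin.le, sin_le_one t⟩
  have hcont : ContinuousAt (fun p => (regKernel (p, sin t) - 2) / (1 - (p * sin t / π) ^ 2)) π :=
    ((hreg.continuousAt.comp (f := fun p => (p, sin t)) (by fun_prop)).sub
      continuousAt_const).div (by fun_prop) hden
  rw [HpiIntegrand_eq_sub_singularPart, HH_sub_singularPart pi_ne_zero hsin.ne']
  refine (hcont.tendsto.mono_left nhdsWithin_le_nhds).congr' ?_
  filter_upwards [Ioo_mem_nhdsLT pi_pos] with p hp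
  exact (HH_sub_singularPart hp.1.ne' hsin.ne').symm

lemma tendsto_integral_HH_sub_singularPart :
    Tendsto (fun p => ∫ t in (0 : ℝ)..π, (HH p t - singularPart p t))
      (𝓝[<] π) (𝓝 (∫ t in (0 : ℝ)..π, HpiIntegrand t)) := by
  obtain ⟨C, hC⟩ := exists_abs_HH_sub_singularPart_le
  refine intervalIntegral.tendsto_integral_filter_of_dominated_convergence (fun _ => C)
    (.of_forall fun p => Measurable.aestronglyMeasurable ?_) ?_ intervalIntegrable_const ?_
  · unfold HH singularPart; fun_prop
  · filter_upwards [Ioo_mem_nhdsLT (by linarith [pi_pos] : π / 2 < π)] with p hp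
    filter_upwards [volume.ae_ne π] with t hne ht
    rw [uIoc_of_le pi_pos.le] at ht
    exact hC p hp t ⟨ht.1, ht.2.lt_of_ne hne⟩
  · filter_upwards [volume.ae_ne π, volume.ae_ne (π / 2)] with t hne hne_half ht
    rw [uIoc_of_le pi_pos.le] at ht
    exact tendsto_HH_sub_singularPart ⟨ht.1, ht.2.lt_of_ne hne⟩ hne_half

lemma cos_sq_add_mul_sin_sq_pos {c : ℝ} (hc : 0 < c) (t : ℝ) :
    0 < cos t ^ 2 + c * sin t ^ 2 := by
  rcases eq_or_ne (cos t) 0 with h | h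
  · have : sin t ≠ 0 := fun h' => by simpa [h, h'] using sin_sq_add_cos_sq t
    positivity
  · positivity

-- On `(-π / 2, π / 2)` the antiderivative is `arctan (a tan t)`, here continued smoothly to `ℝ`.
lemma hasDerivAt_add_arctan {a : ℝ} (ha : 0 < a) (t : ℝ) :
    HasDerivAt (fun t => t + arctan ((a - 1) * sin t * cos t / (cos t ^ 2 + a * sin t ^ 2)))
      (a / (cos t ^ 2 + a ^ 2 * sin t ^ 2)) t := by
  have hnum : HasDerivAt (fun t => (a - 1) * sin t * cos t)
      ((a - 1) * cos t * cos t + (a - 1) * sin t * -sin t) t :=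
    ((hasDerivAt_sin t).const_mul (a - 1)).mul (hasDerivAt_cos t)
  have hden : HasDerivAt (fun t => cos t ^ 2 + a * sin t ^ 2)
      (2 * cos t * -sin t + a * (2 * sin t * cos t)) t := by
    simpa using ((hasDerivAt_cos t).fun_pow 2).fun_add (((hasDerivAt_sin t).fun_pow 2).const_mul a)
  have hden_pos := cos_sq_add_mul_sin_sq_pos ha t
  have htarget_pos := cos_sq_add_mul_sin_sq_pos (pow_pos ha 2) t
  refine ((hasDerivAt_id' t).fun_add (hnum.fun_div hden hden_pos.ne').arctan).congr_deriv ?_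
  have hone_add_sq : 1 + ((a - 1) * sin t * cos t / (cos t ^ 2 + a * sin t ^ 2)) ^ 2 =
      (cos t ^ 2 + a ^ 2 * sin t ^ 2) / (cos t ^ 2 + a * sin t ^ 2) ^ 2 := by
    field_simp
    linear_combination (cos t ^ 2 + a ^ 2 * sin t ^ 2) * sin_sq_add_cos_sq t
  have hwronskian : ((a - 1) * cos t * cos t + (a - 1) * sin t * -sin t) *
      (cos t ^ 2 + a * sin t ^ 2) -
        (a - 1) * sin t * cos t * (2 * cos t * -sin t + a * (2 * sin t * cos t)) =
      a - (cos t ^ 2 + a ^ 2 * sin t ^ 2) := by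
    linear_combination ((a - 1) * (cos t ^ 2 - a * sin t ^ 2) + a) * sin_sq_add_cos_sq t
  rw [hone_add_sq, hwronskian]
  field_simp
  ring

lemma integral_div_cos_sq_add_mul_sin_sq {a : ℝ} (ha : 0 < a) :
    ∫ t in (0 : ℝ)..π, a / (cos t ^ 2 + a ^ 2 * sin t ^ 2) = π := by
  have hcont : Continuous fun t => a / (cos t ^ 2 + a ^ 2 * sin t ^ 2) :=
    continuous_const.div (by fun_prop) fun t => (cos_sq_add_mul_sin_sq_pos (pow_pos ha 2) t).ne'
  rw [intervalIntegral.integral_eq_sub_of_hasDerivAt (fun t _ => hasDerivAt_add_arctan ha t)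
    (hcont.intervalIntegrable _ _)]
  simp

lemma intervalIntegrable_singularPart {p : ℝ} (hp : p ∈ Ioo 0 π) :
    IntervalIntegrable (singularPart p) volume 0 π := by
  refine ContinuousOn.intervalIntegrable <|
    continuousOn_const.div (by fun_prop) fun t ht => ?_
  rw [uIcc_of_le pi_pos.le] at ht
  exact (one_sub_sq_pos hp.1 hp.2 (sin_nonneg_of_mem_Icc ht)).ne'

lemma integral_singularPart {p : ℝ} (hp : p ∈ Ioo 0 π) :
    ∫ t in (0 : ℝ)..π, singularPart p t = 2 * π ^ 2 / √(π ^ 2 - p ^ 2) := by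
  have hsub : 0 < π ^ 2 - p ^ 2 := by nlinarith [hp.1, hp.2]
  have hsqrt : 0 < √(π ^ 2 - p ^ 2) := sqrt_pos.mpr hsub
  set a := √(π ^ 2 - p ^ 2) / π with ha
  have ha_pos : 0 < a := div_pos hsqrt pi_pos
  have ha_sq : a ^ 2 = 1 - p ^ 2 / π ^ 2 := by
    rw [ha, div_pow, sq_sqrt hsub.le, sub_div, div_self (by positivity)]
  have hpart (t : ℝ) : singularPart p t = 2 / a * (a / (cos t ^ 2 + a ^ 2 * sin t ^ 2)) := by
    rw [singularPart, div_mul_div_cancel₀ ha_pos.ne', ha_sq, cos_sq']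
    congr 1
    ring
  simp only [hpart, intervalIntegral.integral_const_mul,
    integral_div_cos_sq_add_mul_sin_sq ha_pos]
  rw [ha]
  field_simp

/-- The argument of the logarithm in `H p`, as an entire function of `v = (p / 2)²`. -/
def logArg (v : ℝ) : ℝ := 2 * coshSqrt v - sinhcSqrt v

lemma logArg_sq {p : ℝ} (hp : p ≠ 0) :
    2 * cosh (p / 2) - 2 / p * sinh (p / 2) = logArg ((p / 2) ^ 2) := by
  rw [logArg, coshSqrt_sq, ← mul_sinhcSqrt_sq]
  field_simp

lemma one_le_logArg {v : ℝ} (hv : 0 ≤ v) : 1 ≤ logArg v := by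
  rw [logArg]
  linarith [sinhcSqrt_le_coshSqrt hv, one_add_half_le_coshSqrt hv]

lemma H_eq_logArg {p : ℝ} (hp : p ≠ 0) :
    H p = p - 2 * log (logArg ((p / 2) ^ 2)) + ∫ t in (0 : ℝ)..π, HH p t := by
  rw [H, logArg_sq hp]

lemma Hpi_eq_logArg :
    Hpi = π - 2 * log (logArg ((π / 2) ^ 2)) + ∫ t in (0 : ℝ)..π, HpiIntegrand t := by
  rw [Hpi, logArg_sq pi_ne_zero]

lemma tendsto_H_sub_sqrt :
    Tendsto (fun p => H p - (2 * π ^ 2 / √(π ^ 2 - p ^ 2) + Hpi)) (𝓝[<] π) (𝓝 0) := by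
  have hcont : Continuous fun p : ℝ => p - 2 * log (logArg ((p / 2) ^ 2)) := by
    have hlog : Continuous fun p : ℝ => log (logArg ((p / 2) ^ 2)) :=
      Continuous.log
        (by unfold logArg; exact (by fun_prop : ContDiff ℝ 0 _).continuous)
        fun p => (zero_lt_one.trans_le (one_le_logArg (sq_nonneg _))).ne'
    fun_prop
  have hsum := (((hcont.tendsto π).mono_left nhdsWithin_le_nhds).add
    tendsto_integral_HH_sub_singularPart).sub_const Hpi
  rw [← Hpi_eq_logArg, sub_self] at hsum
  refine hsum.congr' ?_
  filter_upwards [Ioo_mem_nhdsLT pi_pos] with p hp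
  rw [intervalIntegral.integral_sub (intervalIntegrable_HH hp) (intervalIntegrable_singularPart hp),
    integral_singularPart hp, H_eq_logArg hp.1.ne']
  ring

lemma tendsto_sub_div_sqrt {f : ℝ → ℝ} {a : ℝ} (hf : DifferentiableAt ℝ f a) :
    Tendsto (fun x => (f x - f a) / √(a - x)) (𝓝[<] a) (𝓝 0) := by
  have hslope : Tendsto (slope f a) (𝓝[<] a) (𝓝 (deriv f a)) :=
    (hasDerivAt_iff_tendsto_slope.mp hf.hasDerivAt).mono_left
      (nhdsWithin_mono _ fun x hx => ne_of_lt hx)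
  have hsqrt : Tendsto (fun x => -√(a - x)) (𝓝[<] a) (𝓝 0) := by
    have : ContinuousAt (fun x => -√(a - x)) a := by fun_prop
    simpa using this.tendsto.mono_left nhdsWithin_le_nhds
  have hmul := hslope.mul hsqrt
  rw [mul_zero] at hmul
  refine hmul.congr' ?_
  filter_upwards [self_mem_nhdsWithin] with x hx
  have hpos : 0 < a - x := sub_pos.mpr hx
  rw [slope_def_field, div_mul_eq_mul_div, div_eq_div_iff (by linarith) (sqrt_pos.mpr hpos).ne']
  linear_combination (-(f x - f a)) * (mul_self_sqrt hpos.le)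

lemma sqrt_two_mul_pi_rpow : √2 * π ^ (3 / 2 : ℝ) = π * √(π + π) := by
  rw [show (3 / 2 : ℝ) = 1 + 1 / 2 by norm_num, rpow_add pi_pos, rpow_one, ← sqrt_eq_rpow,
    ← two_mul, sqrt_mul zero_le_two]
  ring

lemma differentiableAt_sqrt_pi_add : DifferentiableAt ℝ (fun p => √(π + p)) π :=
  DifferentiableAt.sqrt (by fun_prop) (by positivity)

lemma tendsto_div_sqrt_sub_rpow :
    Tendsto (fun p => 2 * π ^ 2 / √(π ^ 2 - p ^ 2) - √2 * π ^ (3 / 2 : ℝ) / √(π - p))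
      (𝓝[<] π) (𝓝 0) := by
  have hdiff : DifferentiableAt ℝ (fun p => 2 * π ^ 2 / √(π + p)) π :=
    (differentiableAt_const _).div differentiableAt_sqrt_pi_add (by positivity)
  have hvalue : 2 * π ^ 2 / √(π + π) = √2 * π ^ (3 / 2 : ℝ) := by
    rw [sqrt_two_mul_pi_rpow, div_eq_iff (by positivity)]
    linear_combination (-π) * mul_self_sqrt (by positivity : 0 ≤ π + π)
  refine (tendsto_sub_div_sqrt hdiff).congr' ?_
  filter_upwards [Ioo_mem_nhdsLT pi_pos] with p hp
  rw [hvalue, sub_div, div_div, ← sqrt_mul (by linarith [hp.1, pi_pos])]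
  congr 4
  ring

lemma mul_sqrt_div_eq {p : ℝ} (hp : p ∈ Ioo 0 π) :
    p * √((π + p) / (π - p)) = p * √(π + p) / √(π - p) := by
  rw [sqrt_div (by linarith [pi_pos, hp.1]), mul_div_assoc]

lemma tendsto_rpow_sub_mul_sqrt :
    Tendsto (fun p => √2 * π ^ (3 / 2 : ℝ) / √(π - p) - p * √((π + p) / (π - p)))
      (𝓝[<] π) (𝓝 0) := by
  have hdiff : DifferentiableAt ℝ (fun p => -(p * √(π + p))) π :=
    (differentiableAt_id.mul differentiableAt_sqrt_pi_add).neg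
  refine (tendsto_sub_div_sqrt hdiff).congr' ?_
  filter_upwards [Ioo_mem_nhdsLT pi_pos] with p hp
  rw [mul_sqrt_div_eq hp, sqrt_two_mul_pi_rpow]
  ring

lemma tendsto_H_sub_rpow :
    Tendsto (fun p => H p - (√2 * π ^ (3 / 2 : ℝ) / √(π - p) + Hpi)) (𝓝[<] π) (𝓝 0) := by
  have hsum := tendsto_H_sub_sqrt.add tendsto_div_sqrt_sub_rpow
  rw [add_zero] at hsum
  exact hsum.congr fun p => by ring

lemma tendsto_H_sub_mul_sqrt :
    Tendsto (fun p => H p - (p * √((π + p) / (π - p)) + Hpi)) (𝓝[<] π) (𝓝 0) := by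
  have hsum := tendsto_H_sub_rpow.add tendsto_rpow_sub_mul_sqrt
  rw [add_zero] at hsum
  exact hsum.congr fun p => by ring

/-! ### Behaviour as `p → 0` -/

/-- The expansion `f q y = f₀ y + q f₁ y + O(q²)` with continuous coefficients, the quotient of the
error by `q²` being continuous in both variables. -/
def HasExpansion {Y : Type*} [TopologicalSpace Y] (f : ℝ → Y → ℝ) (f₀ f₁ : Y → ℝ) : Prop :=
  Continuous f₀ ∧ Continuous f₁ ∧ ∃ r : ℝ → Y → ℝ, Continuous (fun x : ℝ × Y => r x.1 x.2) ∧
    ∀ q y, f q y = f₀ y + q * f₁ y + q ^ 2 * r q y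

namespace HasExpansion

variable {Y : Type*} [TopologicalSpace Y] {f g : ℝ → Y → ℝ} {f₀ f₁ g₀ g₁ h₀ h₁ ℓ : Y → ℝ}

lemma affine (h₀_cont : Continuous h₀) (h₁_cont : Continuous h₁) :
    HasExpansion (fun q y => h₀ y + q * h₁ y) h₀ h₁ :=
  ⟨h₀_cont, h₁_cont, fun _ _ => 0, continuous_const, fun q y => by ring⟩

lemma powSum_mul {a : ℕ → ℝ} (ha : ExpBounded a) (hℓ : Continuous ℓ) :
    HasExpansion (fun q y => powSum a (q * ℓ y)) (fun _ => a 0) fun y => a 1 * ℓ y := by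
  have hcont : Continuous (powSum fun k => a (k + 2)) := (ha.shift 2).contDiff_powSum.continuous
  refine ⟨continuous_const, by fun_prop, fun q y => ℓ y ^ 2 * powSum (fun k => a (k + 2)) (q * ℓ y),
    by fun_prop, fun q y => ?_⟩
  beta_reduce
  rw [ha.powSum_eq_sum_add 2, Finset.sum_range_succ, Finset.sum_range_one]
  ring

lemma continuous_uncurry (hf : HasExpansion f f₀ f₁) : Continuous fun x : ℝ × Y => f x.1 x.2 := by
  obtain ⟨hf₀, hf₁, r, hr, hfr⟩ := hf
  simp only [hfr]
  fun_prop

lemma add (hf : HasExpansion f f₀ f₁) (hg : HasExpansion g g₀ g₁) :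
    HasExpansion (fun q y => f q y + g q y) (fun y => f₀ y + g₀ y) fun y => f₁ y + g₁ y := by
  obtain ⟨hf₀, hf₁, r, hr, hfr⟩ := hf
  obtain ⟨hg₀, hg₁, s, hs, hgs⟩ := hg
  exact ⟨by fun_prop, by fun_prop, fun q y => r q y + s q y, by fun_prop, fun q y => by
    simp only [hfr, hgs]; ring⟩

lemma mul (hf : HasExpansion f f₀ f₁) (hg : HasExpansion g g₀ g₁) :
    HasExpansion (fun q y => f q y * g q y) (fun y => f₀ y * g₀ y)
      fun y => f₀ y * g₁ y + f₁ y * g₀ y := by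
  have hf_cont := hf.continuous_uncurry
  obtain ⟨hf₀, hf₁, r, hr, hfr⟩ := hf
  obtain ⟨hg₀, hg₁, s, hs, hgs⟩ := hg
  refine ⟨by fun_prop, by fun_prop,
    fun q y => f q y * s q y + r q y * (g₀ y + q * g₁ y) + f₁ y * g₁ y, by fun_prop, fun q y => ?_⟩
  beta_reduce
  rw [hgs, hfr]
  ring

lemma exists_abs_div_sub_le (hf : HasExpansion f (fun y => h₀ y * g₀ y)
    fun y => h₀ y * g₁ y + h₁ y * g₀ y) (hg : HasExpansion g g₀ g₁) (h₀_cont : Continuous h₀)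
    (h₁_cont : Continuous h₁) {K : Set (ℝ × Y)} (hK : IsCompact K)
    (hne : ∀ x ∈ K, g x.1 x.2 ≠ 0) :
    ∃ C, ∀ x ∈ K, |f x.1 x.2 / g x.1 x.2 - (h₀ x.2 + x.1 * h₁ x.2)| ≤ C * x.1 ^ 2 := by
  have hg_cont := hg.continuous_uncurry
  obtain ⟨-, -, r, hr, hfr⟩ := hf
  obtain ⟨-, -, s, hs, hgs⟩ := (affine h₀_cont h₁_cont).mul hg
  beta_reduce at hfr hgs
  have hquot : ContinuousOn (fun x : ℝ × Y => (r x.1 x.2 - s x.1 x.2) / g x.1 x.2) K :=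
    (by fun_prop : ContinuousOn _ K).div hg_cont.continuousOn hne
  obtain ⟨C, hC⟩ := hK.exists_bound_of_continuousOn hquot
  refine ⟨C, fun x hx => ?_⟩
  have herror : f x.1 x.2 / g x.1 x.2 - (h₀ x.2 + x.1 * h₁ x.2) =
      (r x.1 x.2 - s x.1 x.2) / g x.1 x.2 * x.1 ^ 2 := by
    rw [div_sub' (hne x hx), div_mul_eq_mul_div, mul_comm (g _ _), hgs, hfr]
    ring
  rw [herror, abs_mul, abs_of_nonneg (sq_nonneg x.1)]
  exact mul_le_mul_of_nonneg_right (hC x hx) (sq_nonneg _)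

end HasExpansion

/-- The quotient of `kernelNum (-qy) (q(1 - y))` by `q`. -/
def scaledNum (q y : ℝ) : ℝ :=
  besselSqrt (q * -y) * ((1 - y) * coshSlope (q * (1 - y)) + y * coshSlope (q * -y))

/-- The quotient of `kernelDen (-qy) (q(1 - y))` by `q`. -/
def scaledDen (q y : ℝ) : ℝ :=
  y * coshSlope (q * -y) + (y - 1) * coshSlope (q * (1 - y))
    + q * (y * (1 - y)) * (coshSlope (q * -y) * coshSlope (q * (1 - y)))
    + (1 - y) * (sinhcSqrt (q * -y) * sinhcSqrt (q * (1 - y)))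

lemma kernelNum_eq_mul_scaledNum (q y : ℝ) :
    kernelNum (q * -y) (q * (1 - y)) = q * scaledNum q y := by
  rw [kernelNum, scaledNum, coshSqrt_eq_one_add, coshSqrt_eq_one_add]
  ring

lemma kernelDen_eq_mul_scaledDen (q y : ℝ) :
    kernelDen (q * -y) (q * (1 - y)) = q * scaledDen q y := by
  rw [kernelDen, scaledDen, coshSqrt_eq_one_add, coshSqrt_eq_one_add]
  ring

lemma HH_eq_scaledNum_div_scaledDen {p t : ℝ} (hp : p ≠ 0) (ht : sin t ≠ 0) :
    HH p t = p ^ 2 * sin t * (scaledNum (p ^ 2) (sin t ^ 2) /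
      (sinhcSqrt (p ^ 2 * -sin t ^ 2) * scaledDen (p ^ 2) (sin t ^ 2))) := by
  have ha : -(p * sin t) ^ 2 = p ^ 2 * -sin t ^ 2 := by ring
  have hb : (p * cos t) ^ 2 = p ^ 2 * (1 - sin t ^ 2) := by rw [← cos_sq']; ring
  rw [HH_eq_kernelNum_div_kernelDen hp ht, ha, hb, kernelNum_eq_mul_scaledNum,
    kernelDen_eq_mul_scaledDen, ← mul_div_assoc, ← mul_div_mul_left _ (_ * scaledDen _ _)
    (pow_ne_zero 2 hp)]
  congr 1 <;> ring

lemma hasExpansion_coshSlope {ℓ : ℝ → ℝ} (hℓ : Continuous ℓ) :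
    HasExpansion (fun q y => coshSlope (q * ℓ y)) (fun _ => 1 / 2) fun y => 1 / 24 * ℓ y := by
  convert HasExpansion.powSum_mul (expBounded_coshCoeff.shift 1) hℓ using 1
  · rfl
  · norm_num [coshCoeff, Nat.factorial]
  · norm_num [coshCoeff, Nat.factorial]

lemma hasExpansion_sinhcSqrt {ℓ : ℝ → ℝ} (hℓ : Continuous ℓ) :
    HasExpansion (fun q y => sinhcSqrt (q * ℓ y)) (fun _ => 1) fun y => 1 / 6 * ℓ y := by
  convert HasExpansion.powSum_mul expBounded_sinhcCoeff hℓ using 1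
  · rfl
  · norm_num [sinhcCoeff, Nat.factorial]
  · norm_num [sinhcCoeff, Nat.factorial]

lemma hasExpansion_besselSqrt {ℓ : ℝ → ℝ} (hℓ : Continuous ℓ) :
    HasExpansion (fun q y => besselSqrt (q * ℓ y)) (fun _ => 1 / 3) fun y => 1 / 30 * ℓ y := by
  convert HasExpansion.powSum_mul expBounded_besselCoeff hℓ using 1
  · rfl
  · norm_num [besselCoeff, Nat.factorial]
  · norm_num [besselCoeff, Nat.factorial]

lemma hasExpansion_scaledNum :
    HasExpansion scaledNum (fun _ => 1 / 6) fun y => (1 - 2 * y) / 72 - y / 60 := by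
  have hcoeff (h₀ : ℝ → ℝ) (h : Continuous h₀) :=
    HasExpansion.affine h (continuous_const (y := (0 : ℝ)))
  have := (hasExpansion_besselSqrt (ℓ := fun y => -y) (by fun_prop)).mul
    (((hcoeff (fun y => 1 - y) (by fun_prop)).mul
      (hasExpansion_coshSlope (ℓ := fun y => 1 - y) (by fun_prop))).add
    ((hcoeff (fun y => y) (by fun_prop)).mul
      (hasExpansion_coshSlope (ℓ := fun y => -y) (by fun_prop))))
  convert this using 1
  · funext q y; simp [scaledNum]
  · funext y; ring
  · funext y; ring

lemma hasExpansion_scaledDen :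
    HasExpansion scaledDen (fun _ => 1 / 2) fun y => (3 - 4 * y) / 24 := by
  have hcoeff (h₀ h₁ : ℝ → ℝ) (h : Continuous h₀) (h' : Continuous h₁) := HasExpansion.affine h h'
  have hslope := hasExpansion_coshSlope (ℓ := fun y => 1 - y) (by fun_prop)
  have hslope_neg := hasExpansion_coshSlope (ℓ := fun y => -y) (by fun_prop)
  have := ((((hcoeff (fun y => y) 0 (by fun_prop) (by fun_prop)).mul hslope_neg).add
    ((hcoeff (fun y => y - 1) 0 (by fun_prop) (by fun_prop)).mul hslope)).add
    ((hcoeff 0 (fun y => y * (1 - y)) (by fun_prop) (by fun_prop)).mul (hslope_neg.mul hslope))).add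
    ((hcoeff (fun y => 1 - y) 0 (by fun_prop) (by fun_prop)).mul
    ((hasExpansion_sinhcSqrt (ℓ := fun y => -y) (by fun_prop)).mul
      (hasExpansion_sinhcSqrt (ℓ := fun y => 1 - y) (by fun_prop))))
  convert this using 1
  · funext q y; simp [scaledDen]
  · funext y; simp only [Pi.zero_apply]; ring
  · funext y; simp only [Pi.zero_apply]; ring

lemma scaledDen_pos {q y : ℝ} (hq : q ∈ Icc 0 1) (hy : y ∈ Icc 0 1) : 0 < scaledDen q y := by
  rcases hq.1.eq_or_lt with rfl | hq0
  · obtain ⟨-, -, r, -, hr⟩ := hasExpansion_scaledDen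
    norm_num [hr]
  · have hpos : 0 < kernelDen (-√(q * y) ^ 2) (q * (1 - y)) := by
      refine kernelDen_pos (sqrt_nonneg _) ?_ (mul_nonneg hq.1 (sub_nonneg.mpr hy.2)) ?_
      · refine (sqrt_le_one.mpr (mul_le_one₀ hq.2 hy.1 hy.2)).trans (by linarith [pi_gt_three])
      · rcases hy.1.eq_or_lt with rfl | hy0
        · exact .inr (by simp [hq0.ne'])
        · exact .inl (by positivity)
    rw [sq_sqrt (mul_nonneg hq.1 hy.1), ← mul_neg, kernelDen_eq_mul_scaledDen] at hpos
    exact pos_of_mul_pos_right hpos hq.1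

lemma sinhcSqrt_mul_scaledDen_pos {q y : ℝ} (hq : q ∈ Icc 0 1) (hy : y ∈ Icc 0 1) :
    0 < sinhcSqrt (q * -y) * scaledDen q y := by
  have hsqrt : √(q * y) < π :=
    (sqrt_le_one.mpr (mul_le_one₀ hq.2 hy.1 hy.2)).trans_lt (by linarith [pi_gt_three])
  have hpos := sinhcSqrt_pos (sqrt_nonneg _) hsqrt
  rw [sq_sqrt (mul_nonneg hq.1 hy.1), ← mul_neg] at hpos
  exact mul_pos hpos (scaledDen_pos hq hy)

lemma exists_abs_HH_sub_le : ∃ C, ∀ p ∈ Ioc 0 1, ∀ t ∈ Ioo 0 π,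
    |HH p t - p ^ 2 * sin t * (1 / 3 + p ^ 2 * (7 * sin t ^ 2 - 5) / 90)| ≤ C * p ^ 6 := by
  have hden := (hasExpansion_sinhcSqrt (ℓ := fun y => -y) (by fun_prop)).mul hasExpansion_scaledDen
  have hnum : HasExpansion scaledNum (fun _ => 1 / 3 * (1 * (1 / 2)))
      (fun y => 1 / 3 * (1 * ((3 - 4 * y) / 24) + 1 / 6 * -y * (1 / 2))
        + (7 * y - 5) / 90 * (1 * (1 / 2))) := by
    convert hasExpansion_scaledNum using 1
    · funext _; ring
    · funext y; ring
  obtain ⟨C, hC⟩ := hnum.exists_abs_div_sub_le (h₀ := fun _ => 1 / 3)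
    (h₁ := fun y => (7 * y - 5) / 90) hden (by fun_prop) (by fun_prop)
    (isCompact_Icc.prod isCompact_Icc : IsCompact (Icc (0 : ℝ) 1 ×ˢ Icc (0 : ℝ) 1))
    fun x hx => (sinhcSqrt_mul_scaledDen_pos hx.1 hx.2).ne'
  refine ⟨C, fun p hp t ht => ?_⟩
  have hsin : 0 < sin t := sin_pos_of_mem_Ioo ht
  have hbound := hC (p ^ 2, sin t ^ 2) ⟨⟨sq_nonneg p, pow_le_one₀ hp.1.le hp.2⟩,
    sq_nonneg _, pow_le_one₀ hsin.le (sin_le_one t)⟩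
  rw [HH_eq_scaledNum_div_scaledDen hp.1.ne' hsin.ne', mul_div_assoc, ← mul_sub, abs_mul,
    abs_mul, abs_of_pos hsin, abs_of_nonneg (sq_nonneg p)]
  calc _ ≤ p ^ 2 * 1 * (C * (p ^ 2) ^ 2) :=
        mul_le_mul (by gcongr; exact sin_le_one t) hbound (abs_nonneg _) (by positivity)
    _ = C * p ^ 6 := by ring

lemma integral_HH_expansion (p : ℝ) :
    ∫ t in (0 : ℝ)..π, p ^ 2 * sin t * (1 / 3 + p ^ 2 * (7 * sin t ^ 2 - 5) / 90) =
      2 / 3 * p ^ 2 - p ^ 4 / 135 := by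
  have hderiv (t : ℝ) : HasDerivAt
      (fun t => 7 / 270 * p ^ 4 * cos t ^ 3 - p ^ 2 * (1 / 3 + p ^ 2 / 45) * cos t)
      (p ^ 2 * sin t * (1 / 3 + p ^ 2 * (7 * sin t ^ 2 - 5) / 90)) t := by
    refine ((((hasDerivAt_cos t).fun_pow 3).const_mul (7 / 270 * p ^ 4)).fun_sub
      ((hasDerivAt_cos t).const_mul (p ^ 2 * (1 / 3 + p ^ 2 / 45)))).congr_deriv ?_
    rw [sin_sq]
    push_cast
    ring
  rw [intervalIntegral.integral_eq_sub_of_hasDerivAt (fun t _ => hderiv t)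
    (Continuous.intervalIntegrable (by fun_prop) _ _)]
  simp only [cos_pi, cos_zero]
  ring

lemma isBigO_integral_HH_sub :
    (fun p : ℝ => (∫ t in (0 : ℝ)..π, HH p t) - (2 / 3 * p ^ 2 - p ^ 4 / 135))
      =O[𝓝[>] 0] fun p => p ^ 6 := by
  obtain ⟨C, hC⟩ := exists_abs_HH_sub_le
  refine IsBigO.of_bound (C * π) ?_
  filter_upwards [Ioo_mem_nhdsGT (one_pos : (0 : ℝ) < 1)] with p hp
  rw [← integral_HH_expansion, ← intervalIntegral.integral_sub
    (intervalIntegrable_HH ⟨hp.1, by linarith [hp.2, pi_gt_three]⟩)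
    (Continuous.intervalIntegrable (by fun_prop) _ _)]
  refine (intervalIntegral.norm_integral_le_of_norm_le_const_ae (C := C * p ^ 6) ?_).trans_eq ?_
  · filter_upwards [volume.ae_ne π] with t hne ht
    rw [uIoc_of_le pi_pos.le] at ht
    exact hC p ⟨hp.1, hp.2.le⟩ t ⟨ht.1, ht.2.lt_of_ne hne⟩
  · rw [sub_zero, abs_of_pos pi_pos, Real.norm_eq_abs, abs_of_pos (pow_pos hp.1 6)]
    ring

lemma isBigO_log_one_add :
    (fun x : ℝ => log (1 + x) - (x - x ^ 2 / 2)) =O[𝓝 0] fun x => x ^ 3 := by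
  refine IsBigO.of_bound 2 ?_
  filter_upwards [Metric.ball_mem_nhds (0 : ℝ) one_half_pos] with x hx
  rw [Metric.mem_ball, dist_zero_right, Real.norm_eq_abs] at hx
  have htaylor := Real.abs_log_sub_add_sum_range_le (x := -x) (by rw [abs_neg]; linarith) 2
  have hsum : (∑ i ∈ Finset.range 2, (-x) ^ (i + 1) / (i + 1)) + log (1 - -x) =
      log (1 + x) - (x - x ^ 2 / 2) := by
    norm_num [Finset.sum_range_succ]; ring
  rw [hsum, abs_neg] at htaylor
  rw [Real.norm_eq_abs, Real.norm_eq_abs, abs_pow]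
  refine htaylor.trans ?_
  change |x| ^ 3 / (1 - |x|) ≤ 2 * |x| ^ 3
  rw [div_le_iff₀ (by linarith)]
  nlinarith [mul_nonneg (pow_nonneg (abs_nonneg x) 3) (sub_nonneg.mpr hx.le)]

lemma isBigO_pow_mul {f : ℝ → ℝ} (hf : Continuous f) (n : ℕ) :
    (fun v => v ^ n * f v) =O[𝓝 0] fun v => v ^ n := by
  simpa using (isBigO_refl (fun v : ℝ => v ^ n) (𝓝 0)).mul ((hf.tendsto 0).isBigO_one ℝ)

lemma exists_logArg_eq : ∃ r : ℝ → ℝ, Continuous r ∧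
    ∀ v, logArg v = 1 + (5 / 6 * v + 3 / 40 * v ^ 2 + v ^ 3 * r v) := by
  have hcosh := (expBounded_coshCoeff.shift 3).contDiff_powSum.continuous
  have hsinhc := (expBounded_sinhcCoeff.shift 3).contDiff_powSum.continuous
  refine ⟨fun v => 2 * powSum (fun k => coshCoeff (k + 3)) v
    - powSum (fun k => sinhcCoeff (k + 3)) v, by fun_prop, fun v => ?_⟩
  rw [logArg, coshSqrt, sinhcSqrt, expBounded_coshCoeff.powSum_eq_sum_add 3,
    expBounded_sinhcCoeff.powSum_eq_sum_add 3]
  norm_num [Finset.sum_range_succ, coshCoeff, sinhcCoeff, Nat.factorial]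
  ring

lemma isBigO_log_logArg :
    (fun v => log (logArg v) - (5 / 6 * v - 49 / 180 * v ^ 2)) =O[𝓝 0] fun v => v ^ 3 := by
  obtain ⟨r, hr, hlogArg⟩ := exists_logArg_eq
  set x : ℝ → ℝ := fun v => 5 / 6 * v + 3 / 40 * v ^ 2 + v ^ 3 * r v with hx
  have hx_cont : Continuous x := by fun_prop
  have hx_cube : (fun v => x v ^ 3) =O[𝓝 0] fun v => v ^ 3 :=
    (isBigO_pow_mul (f := fun v => (5 / 6 + 3 / 40 * v + v ^ 2 * r v) ^ 3)
      (by fun_prop) 3).congr_left fun v => by simp only [hx]; ring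
  have hlog : (fun v => log (1 + x v) - (x v - x v ^ 2 / 2)) =O[𝓝 0] fun v => x v ^ 3 :=
    isBigO_log_one_add.comp_tendsto (by simpa [hx] using hx_cont.tendsto 0)
  have hpoly : (fun v => x v - x v ^ 2 / 2 - (5 / 6 * v - 49 / 180 * v ^ 2))
      =O[𝓝 0] fun v => v ^ 3 :=
    (isBigO_pow_mul (f := fun v => r v - 5 / 6 * (3 / 40 + v * r v)
      - v * (3 / 40 + v * r v) ^ 2 / 2) (by fun_prop) 3).congr_left fun v => by
        simp only [hx]; ring
  refine ((hlog.trans hx_cube).add hpoly).congr_left fun v => ?_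
  rw [hlogArg]
  ring

lemma isBigO_H_sub : (fun p : ℝ => H p - (p + 1 / 4 * p ^ 2 + 23 / 864 * p ^ 4))
    =O[𝓝[>] 0] fun p => p ^ 6 := by
  have hlog : (fun p : ℝ => log (logArg ((p / 2) ^ 2))
      - (5 / 6 * (p / 2) ^ 2 - 49 / 180 * ((p / 2) ^ 2) ^ 2)) =O[𝓝[>] 0] fun p => p ^ 6 := by
    have hsq : Tendsto (fun p : ℝ => (p / 2) ^ 2) (𝓝[>] 0) (𝓝 0) :=
      ((by simpa using (by fun_prop : Continuous fun p : ℝ => (p / 2) ^ 2).tendsto 0 :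
        Tendsto (fun p : ℝ => (p / 2) ^ 2) (𝓝 0) (𝓝 0))).mono_left nhdsWithin_le_nhds
    refine (isBigO_log_logArg.comp_tendsto hsq).trans (.of_bound 1 (.of_forall fun p => ?_))
    simp only [Function.comp_apply, ← pow_mul, div_pow, norm_div, norm_pow, Real.norm_eq_abs]
    norm_num
    linarith [pow_nonneg (abs_nonneg p) 6]
  refine (isBigO_integral_HH_sub.sub (hlog.const_mul_left 2)).congr' ?_ .rfl
  filter_upwards [self_mem_nhdsWithin] with p hp
  rw [H_eq_logArg (ne_of_gt hp)]
  ring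

/-! ### The crude estimate -/

lemma isEquivalent_H_nhdsGT_zero :
    H ~[𝓝[>] 0] fun p => p * √((π + p) / (π - p)) := by
  have hpow (n : ℕ) (hn : 1 < n) : (fun p : ℝ => p ^ n) =o[𝓝[>] 0] fun p => p := by
    simpa using (isLittleO_pow_pow (𝕜 := ℝ) hn).mono nhdsWithin_le_nhds
  have hH : H ~[𝓝[>] 0] fun p => p := by
    refine ((isBigO_H_sub.trans_isLittleO (hpow 6 (by norm_num))).add
      (((hpow 2 (by norm_num)).const_mul_left (1 / 4)).add
        ((hpow 4 (by norm_num)).const_mul_left (23 / 864)))).congr_left fun p => ?_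
    simp only [Pi.sub_apply]
    ring
  have hsqrt : Tendsto (fun p : ℝ => √((π + p) / (π - p)) - 1) (𝓝[>] 0) (𝓝 0) := by
    have : ContinuousAt (fun p : ℝ => √((π + p) / (π - p)) - 1) 0 :=
      (ContinuousAt.sqrt (ContinuousAt.div (by fun_prop) (by fun_prop) (by simp))).sub
        continuousAt_const
    simpa using this.tendsto.mono_left nhdsWithin_le_nhds
  have hbound : (fun p : ℝ => p * √((π + p) / (π - p))) ~[𝓝[>] 0] fun p => p := by
    refine ((isBigO_refl _ _).mul_isLittleO ((isLittleO_one_iff ℝ).mpr hsqrt)).congr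
      (fun p => ?_) fun p => mul_one p
    simp only [Pi.sub_apply]
    ring
  exact hH.trans hbound.symm

lemma tendsto_mul_sqrt_atTop :
    Tendsto (fun p => p * √((π + p) / (π - p))) (𝓝[<] π) atTop := by
  have hinv : Tendsto (fun p : ℝ => (√(π - p))⁻¹) (𝓝[<] π) atTop := by
    refine tendsto_inv_nhdsGT_zero.comp (tendsto_nhdsWithin_iff.mpr ⟨?_, ?_⟩)
    · have : ContinuousAt (fun p : ℝ => √(π - p)) π := by fun_prop
      simpa using this.tendsto.mono_left nhdsWithin_le_nhds
    · filter_upwards [self_mem_nhdsWithin] with p hp using sqrt_pos.mpr (sub_pos.mpr hp)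
  have hmul : Tendsto (fun p : ℝ => p * √(π + p)) (𝓝[<] π) (𝓝 (π * √(π + π))) :=
    (by fun_prop : Continuous fun p : ℝ => p * √(π + p)).tendsto π |>.mono_left nhdsWithin_le_nhds
  refine (hmul.pos_mul_atTop (by positivity) hinv).congr' ?_
  filter_upwards [Ioo_mem_nhdsLT pi_pos] with p hp
  rw [mul_sqrt_div_eq hp, div_eq_mul_inv]

lemma isEquivalent_H_nhdsLT_pi : H ~[𝓝[<] π] fun p => p * √((π + p) / (π - p)) := by
  have hsub : Tendsto (fun p => H p - p * √((π + p) / (π - p))) (𝓝[<] π) (𝓝 Hpi) := by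
    simpa using (tendsto_H_sub_mul_sqrt.add_const Hpi).congr fun p => by ring
  exact (hsub.isBigO_one ℝ).trans_isLittleO <|
    (isLittleO_const_left (c := (1 : ℝ))).mpr (.inr (tendsto_norm_atTop_atTop.comp
      tendsto_mul_sqrt_atTop))

lemma exists_H_le_one_add_mul :
    ∃ ε : ℝ → ℝ, Tendsto ε (𝓝[>] 0) (𝓝 0) ∧ Tendsto ε (𝓝[<] π) (𝓝 0) ∧
      ∀ p ∈ Ioo (0 : ℝ) π, H p ≤ (1 + ε p) * (p * √((π + p) / (π - p))) := by
  set B : ℝ → ℝ := fun p => p * √((π + p) / (π - p))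
  have hB (p : ℝ) (hp : p ∈ Ioo 0 π) : B p ≠ 0 :=
    (mul_pos hp.1 (sqrt_pos.mpr (div_pos (add_pos pi_pos hp.1) (sub_pos.mpr hp.2)))).ne'
  have hε {l : Filter ℝ} (hl : Ioo 0 π ∈ l) (hH : H ~[l] B) :
      Tendsto (fun p => H p / B p - 1) l (𝓝 0) := by
    simpa using ((isEquivalent_iff_tendsto_one (mem_of_superset hl hB)).mp hH).sub_const 1
  refine ⟨fun p => H p / B p - 1, hε (Ioo_mem_nhdsGT pi_pos) isEquivalent_H_nhdsGT_zero,
    hε (Ioo_mem_nhdsLT pi_pos) isEquivalent_H_nhdsLT_pi, fun p hp => ?_⟩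
  rw [add_sub_cancel, div_mul_cancel₀ _ (hB p hp)]

/-! ### The regularised integrand of `H_π` -/

/-- The function `(cos (π √y) + 1) / (1 - y)`. -/
def cosQuot : ℝ → ℝ := divOneSub fun y => coshSqrt (-(π ^ 2 * y))

/-- The quotient by `1 - y` of `π² besselSqrt (-π² y) - 2 sincQuot y`, which vanishes at `y = 1`. -/
def besselQuot : ℝ → ℝ := divOneSub fun y => π ^ 2 * besselSqrt (-(π ^ 2 * y)) - 2 * sincQuot y

/-- The second factor of `kernelNum` at `p = π`, as a function of `y = sin² t`. -/
def coshSubCos (y : ℝ) : ℝ := coshSqrt (π ^ 2 * (1 - y)) - coshSqrt (-(π ^ 2 * y))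

/-- The quotient by `1 - y` of the difference between `kernelDen` at `p = π` and `coshSubCos y`. -/
def denQuot (y : ℝ) : ℝ :=
  sincQuot y * (π ^ 2 * (1 - y) * sinhcSqrt (π ^ 2 * (1 - y)))
    - cosQuot y * (coshSqrt (π ^ 2 * (1 - y)) - 1)

/-- The denominator of `HH π t` with its zero at `t = π / 2` divided out, as a function of
`y = sin² t`. -/
def regDen (y : ℝ) : ℝ := sincQuot y * kernelDen (-(π ^ 2 * y)) (π ^ 2 * (1 - y))

/-- The numerator belonging to `regDen` once the singular part of `HH π t` is removed. -/
def regNum (y : ℝ) : ℝ := besselQuot y * coshSubCos y - 2 * (sincQuot y * denQuot y)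

/-- The smooth function extending `HpiIntegrand` across `0`, `π / 2` and `π`. -/
def regIntegrand (t : ℝ) : ℝ :=
  sin t * (regNum (sin t ^ 2) / regDen (sin t ^ 2)) - 2 / (1 + sin t)

lemma kernelDen_neg_pi_sq_mul_pos {y : ℝ} (h0 : 0 ≤ y) (h1 : y ≤ 1) :
    0 < kernelDen (-(π ^ 2 * y)) (π ^ 2 * (1 - y)) := by
  have hb : 0 ≤ π ^ 2 * (1 - y) := mul_nonneg (sq_nonneg π) (sub_nonneg.mpr h1)
  rw [← sq_sqrt h0, ← mul_pow, sq_sqrt h0]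
  refine kernelDen_pos (by positivity) (mul_le_of_le_one_right pi_pos.le (sqrt_le_one.mpr h1)) hb ?_
  rcases h0.eq_or_lt with rfl | h
  · exact .inr (by simp)
  · exact .inl (by positivity)

lemma regDen_pos {y : ℝ} (h0 : 0 ≤ y) (h1 : y ≤ 1) : 0 < regDen y :=
  mul_pos (sincQuot_pos h0 h1) (kernelDen_neg_pi_sq_mul_pos h0 h1)

@[fun_prop]
lemma contDiff_cosQuot {n : WithTop ℕ∞} : ContDiff ℝ n cosQuot :=
  contDiff_divOneSub (by fun_prop)

@[fun_prop]
lemma contDiff_besselQuot {n : WithTop ℕ∞} : ContDiff ℝ n besselQuot :=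
  contDiff_divOneSub (by fun_prop)

@[fun_prop]
lemma contDiff_regDen {n : WithTop ℕ∞} : ContDiff ℝ n regDen := by
  unfold regDen kernelDen; fun_prop

@[fun_prop]
lemma contDiff_regNum {n : WithTop ℕ∞} : ContDiff ℝ n regNum := by
  unfold regNum coshSubCos denQuot; fun_prop

lemma one_sub_mul_cosQuot (y : ℝ) : (1 - y) * cosQuot y = coshSqrt (-(π ^ 2 * y)) + 1 := by
  rw [cosQuot, one_sub_mul_divOneSub, mul_one, coshSqrt_neg_pi_sq, sub_neg_eq_add]

lemma one_sub_mul_besselQuot (y : ℝ) :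
    (1 - y) * besselQuot y = π ^ 2 * besselSqrt (-(π ^ 2 * y)) - 2 * sincQuot y := by
  rw [besselQuot, one_sub_mul_divOneSub, mul_one, pi_sq_mul_besselSqrt, sincQuot_one]
  ring

lemma coshSubCos_eq (y : ℝ) :
    coshSubCos y = coshSqrt (π ^ 2 * (1 - y)) + 1 - (1 - y) * cosQuot y := by
  rw [one_sub_mul_cosQuot, coshSubCos]; ring

lemma kernelDen_eq_coshSubCos_add (y : ℝ) :
    kernelDen (-(π ^ 2 * y)) (π ^ 2 * (1 - y)) = coshSubCos y + (1 - y) * denQuot y := by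
  rw [kernelDen, coshSubCos, denQuot]
  linear_combination (coshSqrt (π ^ 2 * (1 - y)) - 1) * one_sub_mul_cosQuot y
    - π ^ 2 * (1 - y) * sinhcSqrt (π ^ 2 * (1 - y)) * one_sub_mul_sincQuot y

lemma one_sub_mul_regNum (y : ℝ) :
    (1 - y) * regNum y = π ^ 2 * kernelNum (-(π ^ 2 * y)) (π ^ 2 * (1 - y)) - 2 * regDen y := by
  rw [regDen, kernelDen_eq_coshSubCos_add, kernelNum, ← coshSubCos, regNum]
  linear_combination coshSubCos y * one_sub_mul_besselQuot y

lemma continuous_regNum_div_regDen_sin_sq :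
    Continuous fun t => sin t * (regNum (sin t ^ 2) / regDen (sin t ^ 2)) := by
  have hnum := contDiff_regNum.continuous (n := 0)
  have hden := contDiff_regDen.continuous (n := 0)
  exact continuous_sin.mul (.div (by fun_prop) (by fun_prop) fun t =>
    (regDen_pos (sq_nonneg _) (sin_sq_le_one t)).ne')

lemma contDiffOn_regIntegrand {n : WithTop ℕ∞} : ContDiffOn ℝ n regIntegrand (Icc 0 π) := by
  intro t ht
  have hden := (regDen_pos (sq_nonneg (sin t)) (sin_sq_le_one t)).ne'
  have hsin : 1 + sin t ≠ 0 := by linarith [sin_nonneg_of_mem_Icc ht]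
  unfold regIntegrand
  exact ContDiffAt.contDiffWithinAt (.sub
    (.mul (by fun_prop) (.div (by fun_prop) (by fun_prop) hden))
    (.div (by fun_prop) (by fun_prop) hsin))

lemma HpiIntegrand_eq_regIntegrand {t : ℝ} (ht : t ∈ Ioo 0 π) (ht' : t ≠ π / 2) :
    HpiIntegrand t = regIntegrand t := by
  have hsin := sin_pos_of_mem_Ioo ht
  have hcos : 1 - sin t ^ 2 ≠ 0 := by
    rw [← cos_sq']; exact pow_ne_zero 2 (cos_ne_zero_of_ne_pi_div_two (Ioo_subset_Icc_self ht) ht')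
  have hden := (regDen_pos (sq_nonneg (sin t)) (sin_sq_le_one t)).ne'
  have hHH : HH π t = sin t * (regNum (sin t ^ 2) / regDen (sin t ^ 2))
      + 2 * sin t / (1 - sin t ^ 2) := by
    have hnum : sin t * (π ^ 2 * kernelNum (-(π ^ 2 * sin t ^ 2)) (π ^ 2 * (1 - sin t ^ 2))) =
        sin t * ((1 - sin t ^ 2) * regNum (sin t ^ 2) + 2 * regDen (sin t ^ 2)) := by
      rw [one_sub_mul_regNum]; ring
    rw [HH_eq_kernelNum_div_kernelDen pi_ne_zero hsin.ne', mul_pow, mul_pow, cos_sq',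
      ← one_sub_mul_sincQuot, mul_assoc (1 - _), ← regDen, mul_right_comm, mul_comm (_ * _) (sin t),
      hnum]
    field_simp
  have hsub : 2 * sin t / (1 - sin t ^ 2) - 2 / (1 - sin t ^ 2) = -(2 / (1 + sin t)) := by
    have : 1 + sin t ≠ 0 := by positivity
    rw [← sub_div, div_eq_iff hcos]
    field_simp
    ring
  rw [HpiIntegrand, hHH, cos_sq', regIntegrand, add_sub_assoc, hsub, sub_eq_add_neg]

lemma ae_HpiIntegrand_eq_regIntegrand :
    ∀ᵐ t : ℝ, t ∈ uIoc 0 π → HpiIntegrand t = regIntegrand t := by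
  filter_upwards [Measure.ae_ne volume (π / 2), Measure.ae_ne volume π] with t hmid hend ht
  rw [uIoc_of_le pi_pos.le] at ht
  exact HpiIntegrand_eq_regIntegrand ⟨ht.1, ht.2.lt_of_ne hend⟩ hmid

lemma intervalIntegrable_regIntegrand : IntervalIntegrable regIntegrand volume 0 π := by
  refine ContinuousOn.intervalIntegrable ?_
  rw [uIcc_of_le pi_pos.le]
  exact (contDiffOn_regIntegrand (n := 0)).continuousOn

lemma intervalIntegrable_HpiIntegrand : IntervalIntegrable HpiIntegrand volume 0 π := by
  refine intervalIntegrable_regIntegrand.congr_ae ?_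
  rw [EventuallyEq, ae_restrict_iff' measurableSet_uIoc]
  filter_upwards [ae_HpiIntegrand_eq_regIntegrand] with t h ht using (h ht).symm

lemma intervalIntegrable_two_div_one_add_sin :
    IntervalIntegrable (fun t => 2 / (1 + sin t)) volume 0 π := by
  refine ContinuousOn.intervalIntegrable ?_
  rw [uIcc_of_le pi_pos.le]
  exact .div (by fun_prop) (by fun_prop) fun t ht => by linarith [sin_nonneg_of_mem_Icc ht]

lemma integral_two_div_one_add_sin : ∫ t in (0 : ℝ)..π, 2 / (1 + sin t) = 4 := by
  have hderiv : ∀ t ∈ uIcc 0 π,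
      HasDerivAt (fun t => -2 * (cos t / (1 + sin t))) (2 / (1 + sin t)) t := by
    intro t ht
    rw [uIcc_of_le pi_pos.le] at ht
    have hne : 1 + sin t ≠ 0 := by linarith [sin_nonneg_of_mem_Icc ht]
    refine (((hasDerivAt_cos t).fun_div ((hasDerivAt_sin t).const_add 1) hne).const_mul
      (-2)).congr_deriv ?_
    field_simp
    linear_combination sin_sq_add_cos_sq t
  rw [intervalIntegral.integral_eq_sub_of_hasDerivAt hderiv intervalIntegrable_two_div_one_add_sin]
  norm_num

lemma integral_HpiIntegrand :
    ∫ t in (0 : ℝ)..π, HpiIntegrand t =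
      (∫ t in (0 : ℝ)..π, sin t * (regNum (sin t ^ 2) / regDen (sin t ^ 2))) - 4 := by
  rw [intervalIntegral.integral_congr_ae ae_HpiIntegrand_eq_regIntegrand]
  unfold regIntegrand
  rw [intervalIntegral.integral_sub
    (continuous_regNum_div_regDen_sin_sq.intervalIntegrable _ _)
    intervalIntegrable_two_div_one_add_sin, integral_two_div_one_add_sin]

/-! ### Polynomials as coefficient lists -/

/-- The value at `u` of the polynomial with the listed coefficients, constant term first. -/
def polyEval : List ℚ → ℝ → ℝ
  | [], _ => 0
  | a :: l, u => a + u * polyEval l u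

/-- The sum of two polynomials. -/
def polyAdd : List ℚ → List ℚ → List ℚ
  | [], m => m
  | a :: l, [] => a :: l
  | a :: l, b :: m => (a + b) :: polyAdd l m

/-- A scalar multiple of a polynomial. -/
def polyScale (r : ℚ) (l : List ℚ) : List ℚ := l.map (r * ·)

/-- The difference of two polynomials. -/
def polySub (l m : List ℚ) : List ℚ := polyAdd l (polyScale (-1) m)

/-- The product of two polynomials. -/
def polyMul : List ℚ → List ℚ → List ℚ
  | [], _ => []
  | a :: l, m => polyAdd (polyScale a m) (0 :: polyMul l m)

/-- The powers of a polynomial. -/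
def polyPow (l : List ℚ) : ℕ → List ℚ
  | 0 => [1]
  | k + 1 => polyMul l (polyPow l k)

/-- The composition of two polynomials. -/
def polyComp : List ℚ → List ℚ → List ℚ
  | [], _ => []
  | a :: l, m => polyAdd [a] (polyMul m (polyComp l m))

/-- The sum of the absolute values of the coefficients, which bounds the polynomial on
`[-1, 1]`. -/
def polyNorm (l : List ℚ) : ℚ := (l.map (|·|)).sum

/-- The first `n` coefficients, rounded down to multiples of `10⁻¹²`. -/
def polyRound (n : ℕ) (l : List ℚ) : List ℚ :=
  (l.take n).map fun a => (⌊a * 10 ^ 12⌋ : ℚ) / 10 ^ 12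

@[simp]
lemma polyEval_nil (u : ℝ) : polyEval [] u = 0 := rfl

@[simp]
lemma polyEval_cons (a : ℚ) (l : List ℚ) (u : ℝ) :
    polyEval (a :: l) u = a + u * polyEval l u := rfl

lemma polyEval_polyAdd (l m : List ℚ) (u : ℝ) :
    polyEval (polyAdd l m) u = polyEval l u + polyEval m u := by
  induction l generalizing m with
  | nil => simp [polyAdd]
  | cons a l ih =>
    cases m with
    | nil => simp [polyAdd]
    | cons b m => simp only [polyAdd, polyEval_cons, ih]; push_cast; ring

lemma polyEval_polyScale (r : ℚ) (l : List ℚ) (u : ℝ) :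
    polyEval (polyScale r l) u = r * polyEval l u := by
  induction l with
  | nil => simp [polyScale]
  | cons a l ih =>
    rw [polyScale] at ih
    simp only [polyScale, List.map_cons, polyEval_cons, ih]
    push_cast
    ring

lemma polyEval_polySub (l m : List ℚ) (u : ℝ) :
    polyEval (polySub l m) u = polyEval l u - polyEval m u := by
  rw [polySub, polyEval_polyAdd, polyEval_polyScale]
  push_cast
  ring

lemma polyEval_polyMul (l m : List ℚ) (u : ℝ) :
    polyEval (polyMul l m) u = polyEval l u * polyEval m u := by
  induction l with
  | nil => simp [polyMul]
  | cons a l ih =>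
    simp only [polyMul, polyEval_cons, polyEval_polyAdd, polyEval_polyScale, ih]
    push_cast
    ring

lemma polyEval_polyPow (l : List ℚ) (k : ℕ) (u : ℝ) :
    polyEval (polyPow l k) u = polyEval l u ^ k := by
  induction k with
  | zero => simp [polyPow]
  | succ k ih => rw [polyPow, polyEval_polyMul, ih, pow_succ']

lemma polyEval_polyComp (l m : List ℚ) (u : ℝ) :
    polyEval (polyComp l m) u = polyEval l (polyEval m u) := by
  induction l with
  | nil => rfl
  | cons a l ih => simp [polyComp, polyEval_polyAdd, polyEval_polyMul, ih]

lemma polyNorm_nonneg (l : List ℚ) : 0 ≤ polyNorm l :=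
  List.sum_nonneg fun _ h => by
    obtain ⟨a, -, rfl⟩ := List.mem_map.mp h
    exact abs_nonneg a

lemma abs_polyEval_le (l : List ℚ) {u : ℝ} (hu : |u| ≤ 1) : |polyEval l u| ≤ polyNorm l := by
  induction l with
  | nil => simp [polyNorm]
  | cons a l ih =>
    rw [polyEval_cons, polyNorm, List.map_cons, List.sum_cons, ← polyNorm]
    push_cast
    refine (abs_add_le _ _).trans (add_le_add le_rfl ?_)
    rw [abs_mul]
    exact (mul_le_of_le_one_left (abs_nonneg _) hu).trans ih

@[fun_prop]
lemma continuous_polyEval (l : List ℚ) : Continuous (polyEval l) := by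
  induction l with
  | nil => exact continuous_const
  | cons a l ih => exact continuous_const.add (continuous_id.mul ih)

/-! ### Taylor models -/

/-- A polynomial approximant together with a bound for its error. -/
structure TaylorModel where
  /-- The coefficients of the approximant. -/
  poly : List ℚ
  /-- The error bound. -/
  err : ℚ

namespace TaylorModel

/-- The model of a polynomial without error. -/
def exact (l : List ℚ) : TaylorModel := ⟨l, 0⟩

/-- A bound on `[0, 1)` for the functions enclosed by a Taylor model. -/
def bound (T : TaylorModel) : ℚ := polyNorm T.poly + T.err

/-- The model of a sum. -/
def add (S T : TaylorModel) : TaylorModel := ⟨polyAdd S.poly T.poly, S.err + T.err⟩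

/-- The model of a difference. -/
def sub (S T : TaylorModel) : TaylorModel := ⟨polySub S.poly T.poly, S.err + T.err⟩

/-- The model of a product. -/
def mul (S T : TaylorModel) : TaylorModel :=
  ⟨polyMul S.poly T.poly, polyNorm S.poly * T.err + S.err * T.bound⟩

/-- The model with degree less than `26` and coefficients of twelve decimals. -/
def round (T : TaylorModel) : TaylorModel :=
  ⟨polyRound 26 T.poly, T.err + polyNorm (polySub T.poly (polyRound 26 T.poly))⟩

end TaylorModel

/-- The Taylor model `T` encloses `f` on `[0, 1)`. Its polynomial is in the variable `u = 1 - 2 y`,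
which ranges over `(-1, 1]`, where `polyNorm` is an effective bound. -/
def Encloses (T : TaylorModel) (f : ℝ → ℝ) : Prop :=
  ∀ y ∈ Ico (0 : ℝ) 1, |f y - polyEval T.poly (1 - 2 * y)| ≤ T.err

lemma abs_one_sub_two_mul_le {y : ℝ} (hy : y ∈ Ico (0 : ℝ) 1) : |1 - 2 * y| ≤ 1 :=
  abs_le.mpr ⟨by linarith [hy.2], by linarith [hy.1]⟩

namespace Encloses

variable {S T : TaylorModel} {f g : ℝ → ℝ}

lemma exact {l : List ℚ} (h : ∀ y, f y = polyEval l (1 - 2 * y)) : Encloses (.exact l) f :=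
  fun y _ => by simp [TaylorModel.exact, h]

lemma const (c : ℚ) : Encloses (.exact [c]) fun _ => c := .exact fun y => by simp

lemma err_nonneg (hT : Encloses T f) : (0 : ℝ) ≤ T.err :=
  (abs_nonneg _).trans (hT 0 ⟨le_rfl, one_pos⟩)

lemma abs_le_bound (hT : Encloses T f) {y : ℝ} (hy : y ∈ Ico (0 : ℝ) 1) : |f y| ≤ T.bound := by
  have hpoly := abs_polyEval_le T.poly (abs_one_sub_two_mul_le hy)
  have hsub := abs_sub_abs_le_abs_sub (f y) (polyEval T.poly (1 - 2 * y))
  rw [TaylorModel.bound]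
  push_cast
  linarith [hT y hy]

lemma abs_le_of_bound_le (hT : Encloses T f) {c : ℚ} (hc : T.bound ≤ c) {y : ℝ}
    (hy : y ∈ Ico (0 : ℝ) 1) : |f y| ≤ c :=
  (hT.abs_le_bound hy).trans (mod_cast hc)

lemma add (hS : Encloses S f) (hT : Encloses T g) : Encloses (S.add T) fun y => f y + g y := by
  intro y hy
  rw [TaylorModel.add, polyEval_polyAdd, add_sub_add_comm]
  push_cast
  exact (abs_add_le _ _).trans (add_le_add (hS y hy) (hT y hy))

lemma sub (hS : Encloses S f) (hT : Encloses T g) : Encloses (S.sub T) fun y => f y - g y := by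
  intro y hy
  rw [TaylorModel.sub, polyEval_polySub, sub_sub_sub_comm]
  push_cast
  exact (abs_sub _ _).trans (add_le_add (hS y hy) (hT y hy))

lemma mul (hS : Encloses S f) (hT : Encloses T g) : Encloses (S.mul T) fun y => f y * g y := by
  intro y hy
  have hsplit : f y * g y - polyEval S.poly (1 - 2 * y) * polyEval T.poly (1 - 2 * y) =
      polyEval S.poly (1 - 2 * y) * (g y - polyEval T.poly (1 - 2 * y))
        + (f y - polyEval S.poly (1 - 2 * y)) * g y := by ring
  rw [TaylorModel.mul, polyEval_polyMul, hsplit]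
  push_cast
  refine (abs_add_le _ _).trans ?_
  rw [abs_mul, abs_mul]
  have hnorm : (0 : ℝ) ≤ polyNorm S.poly := mod_cast polyNorm_nonneg S.poly
  exact add_le_add
    (mul_le_mul (abs_polyEval_le _ (abs_one_sub_two_mul_le hy)) (hT y hy) (abs_nonneg _) hnorm)
    (mul_le_mul (hS y hy) (hT.abs_le_bound hy) (abs_nonneg _) hS.err_nonneg)

lemma round (hT : Encloses T f) : Encloses T.round f := by
  intro y hy
  have hround := abs_polyEval_le (polySub T.poly (polyRound 26 T.poly)) (abs_one_sub_two_mul_le hy)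
  rw [polyEval_polySub] at hround
  simp only [TaylorModel.round]
  push_cast
  exact (abs_sub_le _ _ _).trans (add_le_add (hT y hy) hround)

end Encloses

/-! ### Taylor models of power series in `π²` -/

/-- A rational approximation of `π²`. -/
def piSq : ℚ := 9869604401089 / 10 ^ 12

lemma abs_pi_sq_sub_piSq_le : |π ^ 2 - (piSq : ℝ)| ≤ 1 / 10 ^ 12 := by
  have hlower := pi_gt_d20
  have hupper := pi_lt_d20
  rw [abs_le, piSq]
  push_cast
  constructor <;> nlinarith

lemma pi_sq_le_ten : π ^ 2 ≤ 10 := by nlinarith [pi_lt_d2, pi_pos]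

lemma abs_pi_sq_pow_sub_le (k : ℕ) :
    |(π ^ 2) ^ k - (piSq : ℝ) ^ k| ≤ 1 / 10 ^ 12 * k * 10 ^ k := by
  have hmax : max |π ^ 2| |(piSq : ℝ)| ≤ 10 := by
    refine max_le ?_ ?_
    · rw [abs_of_nonneg (sq_nonneg _)]; exact pi_sq_le_ten
    · rw [piSq]; norm_num [abs_of_pos]
  have hpow : max |π ^ 2| |(piSq : ℝ)| ^ (k - 1) ≤ 10 ^ k :=
    (pow_le_pow_left₀ (le_max_of_le_left (abs_nonneg _)) hmax _).trans
      (pow_le_pow_right₀ (by norm_num) (Nat.sub_le _ _))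
  have hpi := abs_pi_sq_sub_piSq_le
  exact (abs_pow_sub_pow_le _ _ k).trans (by gcongr)

/-- The partial sum `∑ k < n, r k • q k * piSq ^ k`. -/
def seriesPoly (r : ℕ → ℚ) (q : ℕ → List ℚ) : ℕ → List ℚ
  | 0 => []
  | n + 1 => polyAdd (seriesPoly r q n) (polyScale (r n * piSq ^ n) (q n))

/-- A bound for the error in `seriesPoly` caused by replacing `π²` by `piSq`. -/
def seriesErr (r : ℕ → ℚ) (q : ℕ → List ℚ) : ℕ → ℚ
  | 0 => 0
  | n + 1 => seriesErr r q n + |r n| * polyNorm (q n) * (1 / 10 ^ 12 * n * 10 ^ n)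

/-- The Taylor model of the series `∑ r k • q k * (π²) ^ k`, truncated after 14 terms. -/
def TaylorModel.series (r : ℕ → ℚ) (q : ℕ → List ℚ) : TaylorModel :=
  ⟨seriesPoly r q 14, seriesErr r q 14 + 1 / 10 ^ 10⟩

lemma abs_sum_sub_seriesPoly_le (r : ℕ → ℚ) (q : ℕ → List ℚ) (n : ℕ) {u : ℝ} (hu : |u| ≤ 1) :
    |∑ k ∈ Finset.range n, r k * polyEval (q k) u * (π ^ 2) ^ k - polyEval (seriesPoly r q n) u|
      ≤ seriesErr r q n := by
  induction n with
  | zero => simp [seriesPoly, seriesErr]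
  | succ n ih =>
    have hterm : |r n * polyEval (q n) u * ((π ^ 2) ^ n - (piSq : ℝ) ^ n)| ≤
        |(r n : ℝ)| * polyNorm (q n) * (1 / 10 ^ 12 * n * 10 ^ n) := by
      have hnorm : (0 : ℝ) ≤ polyNorm (q n) := mod_cast polyNorm_nonneg (q n)
      rw [abs_mul, abs_mul]
      gcongr
      · exact abs_polyEval_le (q n) hu
      · exact abs_pi_sq_pow_sub_le n
    rw [Finset.sum_range_succ, seriesPoly, seriesErr, polyEval_polyAdd, polyEval_polyScale,
      add_sub_add_comm]
    push_cast
    refine (abs_add_le _ _).trans (add_le_add ih (le_of_eq_of_le ?_ hterm))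
    congr 1
    ring

/-- A bound for the `k`-th term of the series whose Taylor models are used. -/
def tailWeight (k : ℕ) : ℝ := 2 * k / ((2 * k)! : ℝ) * k ^ 2 * 10 ^ k

lemma tailWeight_succ_le {k : ℕ} (hk : 3 ≤ k) : tailWeight (k + 1) ≤ 1 / 2 * tailWeight k := by
  have hk' : (3 : ℝ) ≤ k := mod_cast hk
  have hfactorial : ((2 * (k + 1))! : ℝ) = 2 * (k + 1) * ((2 * k + 1) * (2 * k)!) := by
    rw [Nat.mul_succ, Nat.factorial_succ, Nat.factorial_succ]; push_cast; ring
  have hsucc : tailWeight (k + 1) =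
      10 * (k + 1) ^ 2 / (2 * k + 1) * (10 ^ k / ((2 * k)! : ℝ)) := by
    rw [tailWeight, hfactorial, pow_succ 10 k]
    push_cast
    field_simp
  have hhalf : 1 / 2 * tailWeight k = k ^ 3 * (10 ^ k / ((2 * k)! : ℝ)) := by
    rw [tailWeight]; ring
  rw [hsucc, hhalf]
  gcongr
  rw [div_le_iff₀ (by positivity)]
  nlinarith [mul_nonneg (sub_nonneg.mpr hk') (sub_nonneg.mpr hk'),
    pow_le_pow_left₀ (by norm_num) hk' 3]

lemma tailWeight_add_le (j : ℕ) : tailWeight (j + 14) ≤ 1 / 10 ^ 10 / 2 * (1 / 2) ^ j := by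
  induction j with
  | zero => norm_num [tailWeight, Nat.factorial]
  | succ j ih =>
    rw [add_right_comm, pow_succ (1 / 2 : ℝ)]
    linarith [tailWeight_succ_le (show 3 ≤ j + 14 by omega)]

lemma encloses_series {r : ℕ → ℚ} {q : ℕ → List ℚ} {f : ℝ → ℝ}
    (hf : ∀ y ∈ Ico (0 : ℝ) 1,
      HasSum (fun k => r k * polyEval (q k) (1 - 2 * y) * (π ^ 2) ^ k) (f y))
    (hr : ∀ k ≥ 1, |(r k : ℝ)| ≤ 2 * k / ((2 * k)! : ℝ))
    (hq : ∀ k ≥ 1, ∀ y ∈ Ico (0 : ℝ) 1, |polyEval (q k) (1 - 2 * y)| ≤ (k : ℝ) ^ 2) :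
    Encloses (.series r q) f := by
  intro y hy
  have htail := (hasSum_nat_add_iff' 14).mpr (hf y hy)
  have hgeom : HasSum (fun j : ℕ => (1 : ℝ) / 10 ^ 10 / 2 * (1 / 2) ^ j) (1 / 10 ^ 10) := by
    have := hasSum_geometric_two.mul_left ((1 : ℝ) / 10 ^ 10 / 2)
    rwa [div_mul_cancel₀ _ two_ne_zero] at this
  have hterm (j : ℕ) : ‖r (j + 14) * polyEval (q (j + 14)) (1 - 2 * y) * (π ^ 2) ^ (j + 14)‖ ≤
      1 / 10 ^ 10 / 2 * (1 / 2) ^ j := by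
    refine le_trans ?_ (tailWeight_add_le j)
    have hr' := hr (j + 14) (by omega)
    have hq' := hq (j + 14) (by omega) y hy
    have := pi_sq_le_ten
    rw [norm_mul, norm_mul, norm_pow, norm_of_nonneg (sq_nonneg π), norm_eq_abs, norm_eq_abs,
      tailWeight]
    gcongr
  have htail_le := tsum_of_norm_bounded hgeom hterm
  rw [htail.tsum_eq, norm_eq_abs] at htail_le
  have hhead := abs_sum_sub_seriesPoly_le r q 14 (abs_one_sub_two_mul_le hy)
  simp only [TaylorModel.series]
  push_cast
  linarith [abs_sub_le (f y)
    (∑ k ∈ Finset.range 14, r k * polyEval (q k) (1 - 2 * y) * (π ^ 2) ^ k)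
    (polyEval (seriesPoly r q 14) (1 - 2 * y))]

/-! ### Taylor models of the regularised integrand -/

/-- The polynomial `y` in the variable `u = 1 - 2 y`. -/
def varPoly : List ℚ := [1 / 2, -1 / 2]

/-- The polynomial `1 - y` in the variable `u = 1 - 2 y`. -/
def oneSubPoly : List ℚ := [1 / 2, 1 / 2]

/-- The geometric sum `∑ j < k, y ^ j`. -/
def geomPoly : ℕ → List ℚ
  | 0 => []
  | k + 1 => polyAdd [1] (polyMul varPoly (geomPoly k))

/-- The derivative of `geomPoly k` with respect to `y`. -/
def derivGeomPoly : ℕ → List ℚ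
  | 0 => []
  | k + 1 => polyAdd (geomPoly k) (polyMul varPoly (derivGeomPoly k))

lemma polyEval_varPoly (y : ℝ) : polyEval varPoly (1 - 2 * y) = y := by
  simp only [varPoly, polyEval_cons, polyEval_nil]; push_cast; ring

lemma polyEval_oneSubPoly (y : ℝ) : polyEval oneSubPoly (1 - 2 * y) = 1 - y := by
  simp only [oneSubPoly, polyEval_cons, polyEval_nil]; push_cast; ring

lemma polyEval_geomPoly_succ (k : ℕ) (y : ℝ) :
    polyEval (geomPoly (k + 1)) (1 - 2 * y) = 1 + y * polyEval (geomPoly k) (1 - 2 * y) := by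
  simp [geomPoly, polyEval_polyAdd, polyEval_polyMul, polyEval_varPoly]

lemma polyEval_derivGeomPoly_succ (k : ℕ) (y : ℝ) :
    polyEval (derivGeomPoly (k + 1)) (1 - 2 * y) =
      polyEval (geomPoly k) (1 - 2 * y) + y * polyEval (derivGeomPoly k) (1 - 2 * y) := by
  rw [derivGeomPoly, polyEval_polyAdd, polyEval_polyMul, polyEval_varPoly]

lemma one_sub_mul_polyEval_geomPoly (k : ℕ) (y : ℝ) :
    (1 - y) * polyEval (geomPoly k) (1 - 2 * y) = 1 - y ^ k := by
  induction k with
  | zero => simp [geomPoly]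
  | succ k ih => rw [polyEval_geomPoly_succ]; linear_combination y * ih

lemma one_sub_mul_polyEval_derivGeomPoly (k : ℕ) (y : ℝ) :
    (1 - y) * polyEval (derivGeomPoly k) (1 - 2 * y) =
      polyEval (geomPoly k) (1 - 2 * y) - k * y ^ (k - 1) := by
  induction k with
  | zero => simp [derivGeomPoly, geomPoly]
  | succ k ih =>
    have hpow : (k : ℝ) * y ^ (k - 1) * y = k * y ^ k := by
      cases k with
      | zero => simp
      | succ k => rw [Nat.add_sub_cancel, pow_succ]; ring
    rw [polyEval_derivGeomPoly_succ, polyEval_geomPoly_succ, Nat.add_sub_cancel]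
    push_cast
    linear_combination y * ih + one_sub_mul_polyEval_geomPoly k y - hpow

lemma polyEval_geomPoly_mem_Icc (k : ℕ) {y : ℝ} (hy : y ∈ Ico (0 : ℝ) 1) :
    polyEval (geomPoly k) (1 - 2 * y) ∈ Icc (0 : ℝ) k := by
  induction k with
  | zero => simp [geomPoly]
  | succ k ih =>
    rw [polyEval_geomPoly_succ]
    push_cast
    exact ⟨by linarith [mul_nonneg hy.1 ih.1],
      by linarith [mul_le_of_le_one_left ih.1 hy.2.le, ih.2]⟩

lemma polyEval_derivGeomPoly_mem_Icc (k : ℕ) {y : ℝ} (hy : y ∈ Ico (0 : ℝ) 1) :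
    polyEval (derivGeomPoly k) (1 - 2 * y) ∈ Icc (0 : ℝ) (k ^ 2) := by
  induction k with
  | zero => simp [derivGeomPoly]
  | succ k ih =>
    have hgeom := polyEval_geomPoly_mem_Icc k hy
    rw [polyEval_derivGeomPoly_succ]
    push_cast
    exact ⟨by linarith [mul_nonneg hy.1 ih.1, hgeom.1],
      by nlinarith [mul_le_of_le_one_left ih.1 hy.2.le, ih.2, hgeom.2]⟩

lemma abs_polyEval_geomPoly_le (k : ℕ) {y : ℝ} (hy : y ∈ Ico (0 : ℝ) 1) :
    |polyEval (geomPoly k) (1 - 2 * y)| ≤ (k : ℝ) ^ 2 := by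
  have hgeom := polyEval_geomPoly_mem_Icc k hy
  have : (k : ℝ) ≤ (k : ℝ) ^ 2 := mod_cast Nat.le_self_pow two_ne_zero k
  rw [abs_of_nonneg hgeom.1]
  exact hgeom.2.trans this

lemma abs_polyEval_derivGeomPoly_le (k : ℕ) {y : ℝ} (hy : y ∈ Ico (0 : ℝ) 1) :
    |polyEval (derivGeomPoly k) (1 - 2 * y)| ≤ (k : ℝ) ^ 2 := by
  have hderiv := polyEval_derivGeomPoly_mem_Icc k hy
  rw [abs_of_nonneg hderiv.1]
  exact hderiv.2

lemma abs_polyEval_polyPow_oneSubPoly_le {k : ℕ} (hk : 1 ≤ k) {y : ℝ} (hy : y ∈ Ico (0 : ℝ) 1) :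
    |polyEval (polyPow oneSubPoly k) (1 - 2 * y)| ≤ (k : ℝ) ^ 2 := by
  have hk' : (1 : ℝ) ≤ k := mod_cast hk
  rw [polyEval_polyPow, polyEval_oneSubPoly, abs_of_nonneg (pow_nonneg (by linarith [hy.2]) k)]
  exact (pow_le_one₀ (by linarith [hy.2]) (by linarith [hy.1])).trans (one_le_pow₀ hk')

lemma abs_div_factorial_le {c : ℝ} (hc : |c| ≤ 2) {k n : ℕ} (hk : 1 ≤ k) (hn : 2 * k ≤ n) :
    |c / (n ! : ℝ)| ≤ 2 * k / ((2 * k)! : ℝ) := by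
  have hk' : (1 : ℝ) ≤ k := mod_cast hk
  have hfactorial : ((2 * k)! : ℝ) ≤ n ! := mod_cast Nat.factorial_le hn
  rw [abs_div, Nat.abs_cast]
  gcongr
  linarith

lemma hasSum_geomPoly {a : ℕ → ℝ} (ha : ExpBounded a) {y : ℝ} (hy : y ≠ 1) :
    HasSum (fun k => -(-1) ^ k * a k * polyEval (geomPoly k) (1 - 2 * y) * (π ^ 2) ^ k)
      ((powSum a (-(π ^ 2 * y)) - powSum a (-π ^ 2)) / (1 - y)) := by
  refine (((ha.hasSum (-(π ^ 2 * y))).sub (ha.hasSum (-π ^ 2))).div_const _).congr_fun fun k => ?_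
  rw [eq_div_iff (sub_ne_zero.mpr hy.symm), neg_pow (π ^ 2 * y), neg_pow (π ^ 2) k, mul_pow]
  linear_combination (-(-1) ^ k * a k * (π ^ 2) ^ k) * one_sub_mul_polyEval_geomPoly k y

lemma hasSum_sincQuot {y : ℝ} (hy : y ≠ 1) :
    HasSum (fun k => -(-1) ^ k * sinhcCoeff k * polyEval (geomPoly k) (1 - 2 * y) * (π ^ 2) ^ k)
      (sincQuot y) := by
  have h := hasSum_geomPoly expBounded_sinhcCoeff hy
  rwa [← sinhcSqrt, sinhcSqrt_neg_pi_sq, sub_zero, ← one_sub_mul_sincQuot,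
    mul_div_cancel_left₀ _ (sub_ne_zero.mpr hy.symm)] at h

lemma hasSum_cosQuot {y : ℝ} (hy : y ≠ 1) :
    HasSum (fun k => -(-1) ^ k * coshCoeff k * polyEval (geomPoly k) (1 - 2 * y) * (π ^ 2) ^ k)
      (cosQuot y) := by
  have h := hasSum_geomPoly expBounded_coshCoeff hy
  rwa [← coshSqrt, coshSqrt_neg_pi_sq, sub_neg_eq_add, ← one_sub_mul_cosQuot,
    mul_div_cancel_left₀ _ (sub_ne_zero.mpr hy.symm)] at h

lemma hasSum_pi_sq_mul_besselSqrt (y : ℝ) :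
    HasSum (fun k : ℕ => 2 * k * sinhcCoeff k * (-1) ^ (k + 1) * (π ^ 2) ^ k * y ^ (k - 1))
      (π ^ 2 * besselSqrt (-(π ^ 2 * y))) := by
  rw [← hasSum_nat_add_iff' 1]
  simp only [Finset.sum_range_one, Nat.cast_zero, mul_zero, zero_mul, sub_zero]
  refine ((expBounded_besselCoeff.hasSum (-(π ^ 2 * y))).mul_left (π ^ 2)).congr_fun fun k => ?_
  rw [besselCoeff, sinhcCoeff, neg_pow (π ^ 2 * y), mul_pow, Nat.add_sub_cancel, Nat.mul_succ]
  push_cast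
  ring

lemma hasSum_besselQuot {y : ℝ} (hy : y ≠ 1) :
    HasSum (fun k => 2 * (-1) ^ k * sinhcCoeff k * polyEval (derivGeomPoly k) (1 - 2 * y)
      * (π ^ 2) ^ k) (besselQuot y) := by
  have hne := sub_ne_zero.mpr hy.symm
  have h :=
    ((hasSum_pi_sq_mul_besselSqrt y).sub ((hasSum_sincQuot hy).mul_left 2)).div_const (1 - y)
  rw [← one_sub_mul_besselQuot, mul_div_cancel_left₀ _ hne] at h
  refine h.congr_fun fun k => ?_
  rw [eq_div_iff hne]
  linear_combination
    (2 * (-1) ^ k * sinhcCoeff k * (π ^ 2) ^ k) * one_sub_mul_polyEval_derivGeomPoly k y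

lemma hasSum_mul_sinhcSqrt (v : ℝ) :
    HasSum (fun k : ℕ => 2 * k / ((2 * k)! : ℝ) * v ^ k) (v * sinhcSqrt v) := by
  rw [← hasSum_nat_add_iff' 1]
  simp only [Finset.sum_range_one, Nat.cast_zero, mul_zero, zero_div, zero_mul, sub_zero]
  refine ((expBounded_sinhcCoeff.hasSum v).mul_left v).congr_fun fun k => ?_
  rw [sinhcCoeff, Nat.mul_succ, Nat.factorial_succ (2 * k + 1), pow_succ]
  push_cast
  field_simp
  ring

/-- The Taylor model of `sincQuot`. -/
def sincQuotModel : TaylorModel :=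
  (TaylorModel.series (fun k => -(-1) ^ k / (2 * k + 1)!) geomPoly).round

/-- The Taylor model of `cosQuot`. -/
def cosQuotModel : TaylorModel :=
  (TaylorModel.series (fun k => -(-1) ^ k / (2 * k)!) geomPoly).round

/-- The Taylor model of `besselQuot`. -/
def besselQuotModel : TaylorModel :=
  (TaylorModel.series (fun k => 2 * (-1) ^ k / (2 * k + 1)!) derivGeomPoly).round

/-- The Taylor model of `coshSqrt (π² (1 - y))`. -/
def coshModel : TaylorModel :=
  (TaylorModel.series (fun k => 1 / (2 * k)!) (polyPow oneSubPoly)).round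

/-- The Taylor model of `v * sinhcSqrt v` at `v = π² (1 - y)`. -/
def mulSinhcModel : TaylorModel :=
  (TaylorModel.series (fun k => 2 * k / (2 * k)!) (polyPow oneSubPoly)).round

lemma encloses_sincQuot : Encloses sincQuotModel sincQuot := by
  refine (encloses_series (fun y hy => ?_) (fun k hk => ?_)
    fun k _ y hy => abs_polyEval_geomPoly_le k hy).round
  · refine (hasSum_sincQuot hy.2.ne).congr_fun fun k => ?_
    rw [sinhcCoeff]; push_cast; ring
  · push_cast
    exact abs_div_factorial_le (by simp) hk (by omega)

lemma encloses_cosQuot : Encloses cosQuotModel cosQuot := by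
  refine (encloses_series (fun y hy => ?_) (fun k hk => ?_)
    fun k _ y hy => abs_polyEval_geomPoly_le k hy).round
  · refine (hasSum_cosQuot hy.2.ne).congr_fun fun k => ?_
    rw [coshCoeff]; push_cast; ring
  · push_cast
    exact abs_div_factorial_le (by simp) hk le_rfl

lemma encloses_besselQuot : Encloses besselQuotModel besselQuot := by
  refine (encloses_series (fun y hy => ?_) (fun k hk => ?_)
    fun k _ y hy => abs_polyEval_derivGeomPoly_le k hy).round
  · refine (hasSum_besselQuot hy.2.ne).congr_fun fun k => ?_
    rw [sinhcCoeff]; push_cast; ring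
  · push_cast
    exact abs_div_factorial_le (by simp) hk (by omega)

lemma encloses_coshSqrt : Encloses coshModel fun y => coshSqrt (π ^ 2 * (1 - y)) := by
  refine (encloses_series (fun y _ => ?_) (fun k hk => ?_)
    fun k hk y hy => abs_polyEval_polyPow_oneSubPoly_le hk hy).round
  · refine (expBounded_coshCoeff.hasSum (π ^ 2 * (1 - y))).congr_fun fun k => ?_
    rw [coshCoeff, polyEval_polyPow, polyEval_oneSubPoly, mul_pow]; push_cast; ring
  · push_cast
    exact abs_div_factorial_le (by simp) hk le_rfl

lemma encloses_mul_sinhcSqrt :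
    Encloses mulSinhcModel fun y => π ^ 2 * (1 - y) * sinhcSqrt (π ^ 2 * (1 - y)) := by
  refine (encloses_series (fun y _ => ?_) (fun k _ => ?_)
    fun k hk y hy => abs_polyEval_polyPow_oneSubPoly_le hk hy).round
  · refine (hasSum_mul_sinhcSqrt (π ^ 2 * (1 - y))).congr_fun fun k => ?_
    rw [polyEval_polyPow, polyEval_oneSubPoly, mul_pow]; push_cast; ring
  · push_cast
    rw [abs_of_nonneg (by positivity)]

/-- The Taylor model of `coshSubCos`. -/
def coshSubCosModel : TaylorModel :=
  (coshModel.add (.exact [1])).sub ((TaylorModel.exact oneSubPoly).mul cosQuotModel)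

/-- The Taylor model of `denQuot`. -/
def denQuotModel : TaylorModel :=
  ((sincQuotModel.mul mulSinhcModel).sub (cosQuotModel.mul (coshModel.sub (.exact [1])))).round

/-- The Taylor model of `regNum`. -/
def regNumModel : TaylorModel :=
  ((besselQuotModel.mul coshSubCosModel).sub
    ((TaylorModel.exact [2]).mul (sincQuotModel.mul denQuotModel))).round

/-- The Taylor model of `regDen`. -/
def regDenModel : TaylorModel :=
  (sincQuotModel.mul
    (coshSubCosModel.add ((TaylorModel.exact oneSubPoly).mul denQuotModel))).round

lemma encloses_one_sub : Encloses (.exact oneSubPoly) fun y => 1 - y :=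
  .exact fun y => (polyEval_oneSubPoly y).symm

lemma encloses_coshSubCos : Encloses coshSubCosModel coshSubCos := by
  rw [funext coshSubCos_eq]
  exact_mod_cast (encloses_coshSqrt.add (.const 1)).sub (encloses_one_sub.mul encloses_cosQuot)

lemma encloses_denQuot : Encloses denQuotModel denQuot := by
  have h := ((encloses_sincQuot.mul encloses_mul_sinhcSqrt).sub
    (encloses_cosQuot.mul (encloses_coshSqrt.sub (.const 1)))).round
  rw [Rat.cast_one] at h
  exact h

lemma encloses_regNum : Encloses regNumModel regNum := by
  have h := ((encloses_besselQuot.mul encloses_coshSubCos).sub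
    ((Encloses.const 2).mul (encloses_sincQuot.mul encloses_denQuot))).round
  rw [Rat.cast_ofNat] at h
  exact h

lemma encloses_regDen : Encloses regDenModel regDen := by
  have hregDen (y : ℝ) : regDen y = sincQuot y * (coshSubCos y + (1 - y) * denQuot y) := by
    rw [regDen, kernelDen_eq_coshSubCos_add]
  rw [funext hregDen]
  exact (encloses_sincQuot.mul
    (encloses_coshSubCos.add (encloses_one_sub.mul encloses_denQuot))).round

/-! ### Numerical bounds for `H_π` -/

/-- A polynomial approximation of `regNum / regDen` in the variable `u = 1 - 2 y`, found
numerically. -/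
def quotPoly : List ℚ :=
  polyScale (1 / 10 ^ 9)
    [-192962453, -870233890, 608771833, -233997581, 37684771, 21286081, -22551386, 11502842,
      -3510683, 141733, 607141, -453225, 194894, -45151, -7625, 14418, -8552, 3081, -435]

lemma abs_regNum_sub_quotPoly_mul_le {y : ℝ} (hy : y ∈ Ico (0 : ℝ) 1) :
    |regNum y - polyEval quotPoly (1 - 2 * y) * regDen y| ≤ 1 / 10 ^ 5 := by
  have hbound : (regNumModel.sub ((TaylorModel.exact quotPoly).mul regDenModel)).bound ≤
      1 / 10 ^ 5 := by decide +kernel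
  have h := (encloses_regNum.sub
    ((Encloses.exact fun _ => rfl).mul encloses_regDen)).abs_le_of_bound_le hbound hy
  push_cast at h
  exact h

lemma two_fifths_le_sincQuot {y : ℝ} (hy : y ∈ Ico (0 : ℝ) 1) : 2 / 5 ≤ sincQuot y := by
  have hbound : (sincQuotModel.sub (.exact [3 / 4])).bound ≤ 7 / 20 := by decide +kernel
  have h := (encloses_sincQuot.sub (.const (3 / 4))).abs_le_of_bound_le hbound hy
  push_cast at h
  linarith [(abs_le.mp h).1]

lemma five_fourths_le_kernelDen {y : ℝ} (hy : y ∈ Ico (0 : ℝ) 1) :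
    5 / 4 ≤ kernelDen (-(π ^ 2 * y)) (π ^ 2 * (1 - y)) := by
  have hy1 : 0 < 1 - y := sub_pos.mpr hy.2
  have hs0 : 0 ≤ π * √y := by positivity
  have hspi : π * √y ≤ π := mul_le_of_le_one_right pi_pos.le (sqrt_le_one.mpr hy.2.le)
  have hs : (π * √y) ^ 2 = π ^ 2 * y := by rw [mul_pow, sq_sqrt hy.1]
  have hb : 0 ≤ π ^ 2 * (1 - y) := by positivity
  have hcos : 2 * y ≤ 1 - cos (π * √y) := by
    have h := cos_le_one_sub_mul_cos_sq (x := π * √y) (by rwa [abs_of_nonneg hs0])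
    rw [hs, ← mul_assoc, div_mul_cancel₀ _ (by positivity)] at h
    linarith
  have hcosh : 9 / 2 * (1 - y) ≤ coshSqrt (π ^ 2 * (1 - y)) - 1 := by
    have : 9 ≤ π ^ 2 := by nlinarith [pi_gt_three]
    nlinarith [one_add_half_le_coshSqrt hb]
  have hsinc : (1 - y) * (2 / 5) ≤ sinhcSqrt (-(π ^ 2 * y)) := by
    rw [← one_sub_mul_sincQuot]
    gcongr
    exact two_fifths_le_sincQuot hy
  have hprod := mul_le_mul hsinc hcosh (by positivity) (hsinc.trans' (by positivity))
  have hle := le_kernelDen hs0 hspi hb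
  rw [hs] at hle
  nlinarith [sq_nonneg (1 - y - 5 / 9)]

lemma half_le_regDen {y : ℝ} (hy : y ∈ Ico (0 : ℝ) 1) : 1 / 2 ≤ regDen y := by
  rw [regDen]
  nlinarith [two_fifths_le_sincQuot hy, five_fourths_le_kernelDen hy]

lemma abs_regNum_div_regDen_sub_quotPoly_le {y : ℝ} (hy : y ∈ Ico (0 : ℝ) 1) :
    |regNum y / regDen y - polyEval quotPoly (1 - 2 * y)| ≤ 2 / 10 ^ 5 := by
  have hden := half_le_regDen hy
  have hpos : 0 < regDen y := by linarith
  rw [div_sub' hpos.ne', abs_div, abs_of_pos hpos, div_le_iff₀ hpos, mul_comm (regDen y)]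
  exact (abs_regNum_sub_quotPoly_mul_le hy).trans (by linarith)

/-- The integral over `[-1, 1]` of `x ^ (2 m)` times the given polynomial in `x²`. -/
def evenIntegral : List ℚ → ℕ → ℚ
  | [], _ => 0
  | a :: l, m => 2 * a / (2 * m + 1) + evenIntegral l (m + 1)

lemma integral_sin_mul_cos_sq_pow (m : ℕ) :
    ∫ t in (0 : ℝ)..π, sin t * (cos t ^ 2) ^ m = 2 / (2 * m + 1) := by
  have hne : (2 * m + 1 : ℝ) ≠ 0 := by positivity
  have hderiv (t : ℝ) : HasDerivAt (fun t => -1 / (2 * m + 1) * cos t ^ (2 * m + 1))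
      (sin t * (cos t ^ 2) ^ m) t := by
    refine (((hasDerivAt_cos t).fun_pow (2 * m + 1)).const_mul _).congr_deriv ?_
    rw [Nat.add_sub_cancel, ← pow_mul]
    push_cast
    field_simp
  rw [intervalIntegral.integral_eq_sub_of_hasDerivAt (fun t _ => hderiv t)
    (Continuous.intervalIntegrable (by fun_prop) _ _), cos_pi, cos_zero, one_pow,
    (odd_two_mul_add_one m).neg_one_pow]
  ring

lemma integral_sin_mul_polyEval (l : List ℚ) (m : ℕ) :
    ∫ t in (0 : ℝ)..π, sin t * (cos t ^ 2) ^ m * polyEval l (cos t ^ 2) = evenIntegral l m := by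
  induction l generalizing m with
  | nil => simp [evenIntegral]
  | cons a l ih =>
    have hsplit (t : ℝ) : sin t * (cos t ^ 2) ^ m * polyEval (a :: l) (cos t ^ 2) =
        a * (sin t * (cos t ^ 2) ^ m)
          + sin t * (cos t ^ 2) ^ (m + 1) * polyEval l (cos t ^ 2) := by
      rw [polyEval_cons]; ring
    simp only [hsplit]
    rw [intervalIntegral.integral_add (Continuous.intervalIntegrable (by fun_prop) _ _)
      (Continuous.intervalIntegrable (by fun_prop) _ _), ih, intervalIntegral.integral_const_mul,
      integral_sin_mul_cos_sq_pow, evenIntegral]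
    push_cast
    ring

lemma integral_sin_mul_quotPoly_mem_Icc :
    ∫ t in (0 : ℝ)..π, sin t * polyEval quotPoly (1 - 2 * sin t ^ 2) ∈
      Icc (0.880850 : ℝ) 0.880865 := by
  have hcomp (t : ℝ) : sin t * polyEval quotPoly (1 - 2 * sin t ^ 2) =
      sin t * (cos t ^ 2) ^ 0 * polyEval (polyComp quotPoly [-1, 2]) (cos t ^ 2) := by
    rw [pow_zero, mul_one, polyEval_polyComp, sin_sq]
    congr 2
    simp only [polyEval_cons, polyEval_nil]
    push_cast
    ring
  have hbounds : evenIntegral (polyComp quotPoly [-1, 2]) 0 ∈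
      Icc (880850 / 10 ^ 6 : ℚ) (880865 / 10 ^ 6) := by
    rw [mem_Icc]; decide +kernel
  simp only [hcomp]
  rw [integral_sin_mul_polyEval]
  have hlower : ((880850 / 10 ^ 6 : ℚ) : ℝ) ≤ _ := Rat.cast_le.mpr hbounds.1
  have hupper : _ ≤ ((880865 / 10 ^ 6 : ℚ) : ℝ) := Rat.cast_le.mpr hbounds.2
  push_cast at hlower hupper
  exact ⟨by linarith, by linarith⟩

lemma abs_integral_sub_integral_quotPoly_le :
    |(∫ t in (0 : ℝ)..π, sin t * (regNum (sin t ^ 2) / regDen (sin t ^ 2)))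
      - ∫ t in (0 : ℝ)..π, sin t * polyEval quotPoly (1 - 2 * sin t ^ 2)| ≤ 2 / 10 ^ 5 * π := by
  rw [← intervalIntegral.integral_sub
    (continuous_regNum_div_regDen_sin_sq.intervalIntegrable _ _)
    (Continuous.intervalIntegrable (by fun_prop) _ _), ← norm_eq_abs]
  refine (intervalIntegral.norm_integral_le_of_norm_le_const_ae (C := 2 / 10 ^ 5) ?_).trans_eq
    (by rw [sub_zero, abs_of_pos pi_pos])
  filter_upwards [Measure.ae_ne volume (π / 2)] with t hmid ht
  rw [uIoc_of_le pi_pos.le] at ht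
  have hcos : 0 < cos t ^ 2 :=
    sq_pos_of_ne_zero (cos_ne_zero_of_ne_pi_div_two (Ioc_subset_Icc_self ht) hmid)
  have hquot := abs_regNum_div_regDen_sub_quotPoly_le (y := sin t ^ 2)
    ⟨sq_nonneg _, by linarith [sin_sq_add_cos_sq t]⟩
  rw [← mul_sub, norm_eq_abs, abs_mul]
  exact (mul_le_of_le_one_left (abs_nonneg _) (abs_sin_le_one t)).trans hquot

lemma integral_HpiIntegrand_mem_Icc :
    ∫ t in (0 : ℝ)..π, HpiIntegrand t ∈ Icc (-3.1193 : ℝ) (-3.1190) := by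
  have happrox := abs_le.mp abs_integral_sub_integral_quotPoly_le
  have hquot := integral_sin_mul_quotPoly_mem_Icc
  have hpi := pi_lt_d2
  rw [integral_HpiIntegrand]
  exact ⟨by linarith [happrox.1, hquot.1], by linarith [happrox.2, hquot.2]⟩

/-- The Taylor model of the constant `logArg ((π / 2)²)`. -/
def logArgModel : TaylorModel :=
  .series (fun k => (2 / (2 * k)! - 1 / (2 * k + 1)!) / 4 ^ k) fun _ => [1]

lemma encloses_logArg : Encloses logArgModel fun _ => logArg ((π / 2) ^ 2) := by
  refine encloses_series (fun y _ => ?_) (fun k hk => ?_) fun k hk y _ => ?_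
  · refine (((expBounded_coshCoeff.hasSum _).mul_left 2).sub
      (expBounded_sinhcCoeff.hasSum _)).congr_fun fun k => ?_
    have hpow : ((π / 2) ^ 2) ^ k = (π ^ 2) ^ k / 4 ^ k := by rw [div_pow, div_pow]; norm_num
    simp only [hpow, coshCoeff, sinhcCoeff, polyEval_cons, polyEval_nil]
    push_cast
    ring
  · have hle : 1 / ((2 * k + 1)! : ℝ) ≤ 2 / ((2 * k)! : ℝ) := by
      have : ((2 * k)! : ℝ) ≤ (2 * k + 1)! := mod_cast Nat.factorial_le (Nat.le_succ _)
      gcongr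
      norm_num
    have hk' : 2 / ((2 * k)! : ℝ) ≤ 2 * k / ((2 * k)! : ℝ) := by
      have : (1 : ℝ) ≤ k := mod_cast hk
      gcongr
      linarith
    push_cast
    rw [abs_of_nonneg (div_nonneg (sub_nonneg.mpr hle) (by positivity))]
    refine (div_le_self (sub_nonneg.mpr hle) (one_le_pow₀ (by norm_num))).trans ?_
    exact (sub_le_self _ (by positivity)).trans hk'
  · simpa using (one_le_pow₀ (mod_cast hk) : (1 : ℝ) ≤ (k : ℝ) ^ 2)

lemma logArg_pi_div_two_sq_mem_Icc :
    logArg ((π / 2) ^ 2) ∈ Icc (3.55330 : ℝ) 3.55331 := by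
  have hbound : (logArgModel.sub (.exact [3553305 / 10 ^ 6])).bound ≤ 5 / 10 ^ 6 := by
    decide +kernel
  have h := (encloses_logArg.sub (.const (3553305 / 10 ^ 6))).abs_le_of_bound_le hbound
    (y := 0) (by simp)
  push_cast at h
  have h' := abs_le.mp h
  exact ⟨by linarith [h'.1], by linarith [h'.2]⟩

lemma abs_log_four_mul_one_sub_sub_le {x : ℝ} (h0 : 0 ≤ x) (h1 : x < 1) (n : ℕ) :
    |log (4 * (1 - x)) - (2 * log 2 - ∑ i ∈ Finset.range n, x ^ (i + 1) / (i + 1))| ≤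
      x ^ (n + 1) / (1 - x) := by
  have h := abs_log_sub_add_sum_range_le (by rwa [abs_of_nonneg h0]) n
  have hfour : log 4 = 2 * log 2 := by
    rw [show (4 : ℝ) = 2 ^ 2 by norm_num, log_pow, Nat.cast_two]
  rw [abs_of_nonneg h0] at h
  rw [log_mul four_ne_zero (by linarith), hfour]
  convert! h using 2
  ring

lemma log_logArg_pi_div_two_sq_mem_Icc :
    log (logArg ((π / 2) ^ 2)) ∈ Icc (1.26785 : ℝ) 1.26794 := by
  obtain ⟨hlower, hupper⟩ := logArg_pi_div_two_sq_mem_Icc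
  have hlog_lower := log_le_log (by norm_num) hlower
  have hlog_upper := log_le_log (by linarith) hupper
  rw [show (3.55330 : ℝ) = 4 * (1 - 0.111675) by norm_num] at hlog_lower
  rw [show (3.55331 : ℝ) = 4 * (1 - 0.1116725) by norm_num] at hlog_upper
  have happrox_lower := (abs_le.mp
    (abs_log_four_mul_one_sub_sub_le (x := 0.111675) (by norm_num) (by norm_num) 6)).1
  have happrox_upper := (abs_le.mp
    (abs_log_four_mul_one_sub_sub_le (x := 0.1116725) (by norm_num) (by norm_num) 6)).2
  simp only [Finset.sum_range_succ, Finset.sum_range_zero] at happrox_lower happrox_upper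
  norm_num at happrox_lower happrox_upper hlog_lower hlog_upper
  have := log_two_gt_d9
  have := log_two_lt_d9
  constructor <;> linarith

lemma Hpi_bounds : -2.514 < Hpi ∧ Hpi ≤ -2.513 := by
  obtain ⟨hlog_lower, hlog_upper⟩ := log_logArg_pi_div_two_sq_mem_Icc
  obtain ⟨hint_lower, hint_upper⟩ := integral_HpiIntegrand_mem_Icc
  rw [Hpi_eq_logArg]
  constructor <;> linarith [pi_gt_d6, pi_lt_d6]

end MagnusHilbert

end

theorem mainTheorem4 :
    -- the integrals defining `H p` (`0 < p < π`) and `H_π` converge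
    (∀ p ∈ Ioo (0 : ℝ) π, IntervalIntegrable (MagnusHilbert.HH p) volume 0 π) ∧
    IntervalIntegrable MagnusHilbert.HpiIntegrand volume 0 π ∧
    -- (a) expansion at `0`
    ((fun p : ℝ => MagnusHilbert.H p - (p + 1 / 4 * p ^ 2 + 23 / 864 * p ^ 4))
      =O[𝓝[>] 0] fun p : ℝ => p ^ 6) ∧
    -- (b) behaviour at `π`, in three forms
    ((fun p : ℝ => MagnusHilbert.H p - (2 * π ^ 2 / √(π ^ 2 - p ^ 2) + MagnusHilbert.Hpi))
      =o[𝓝[<] π] fun _ : ℝ => (1 : ℝ)) ∧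
    ((fun p : ℝ => MagnusHilbert.H p
        - (√2 * π ^ (3 / 2 : ℝ) / √(π - p) + MagnusHilbert.Hpi))
      =o[𝓝[<] π] fun _ : ℝ => (1 : ℝ)) ∧
    ((fun p : ℝ => MagnusHilbert.H p - (p * √((π + p) / (π - p)) + MagnusHilbert.Hpi))
      =o[𝓝[<] π] fun _ : ℝ => (1 : ℝ)) ∧
    -- the integrand of `H_π` is a smooth function of `t` on `[0, π]` (singularities removed)
    (∃ g : ℝ → ℝ, ContDiffOn ℝ ∞ g (Icc 0 π) ∧
      ∀ t ∈ Ioo (0 : ℝ) π, t ≠ π / 2 → MagnusHilbert.HpiIntegrand t = g t) ∧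
    -- the decimal expansion `H_π = -2.513…`
    (-2.514 < MagnusHilbert.Hpi ∧ MagnusHilbert.Hpi ≤ -2.513) ∧
    -- (c) crude estimate
    (∃ ε : ℝ → ℝ, Tendsto ε (𝓝[>] 0) (𝓝 0) ∧ Tendsto ε (𝓝[<] π) (𝓝 0) ∧
      ∀ p ∈ Ioo (0 : ℝ) π,
        MagnusHilbert.H p ≤ (1 + ε p) * (p * √((π + p) / (π - p)))) :=
  ⟨fun _ hp => MagnusHilbert.intervalIntegrable_HH hp,
    MagnusHilbert.intervalIntegrable_HpiIntegrand,
    MagnusHilbert.isBigO_H_sub,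
    (isLittleO_one_iff ℝ).mpr MagnusHilbert.tendsto_H_sub_sqrt,
    (isLittleO_one_iff ℝ).mpr MagnusHilbert.tendsto_H_sub_rpow,
    (isLittleO_one_iff ℝ).mpr MagnusHilbert.tendsto_H_sub_mul_sqrt,
    ⟨MagnusHilbert.regIntegrand, MagnusHilbert.contDiffOn_regIntegrand,
      fun _ ht ht_ne => MagnusHilbert.HpiIntegrand_eq_regIntegrand ht ht_ne⟩,
    MagnusHilbert.Hpi_bounds,
    MagnusHilbert.exists_H_le_one_add_mul⟩
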